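/- Let $L\ge M\ge 0$ be integers, not both zero, let $\mathbb T=\{(x,y,z)\in\mathbb Z^3: x\ge 0,\ 0\le y\le L,\ 0\le z\le M\}$ and put $W=(L+1)(M+1)$. Let $\mathcal P_{\mathbb T}$ be the set of self-avoiding polygons (cycles of the cubic lattice, unrooted and unoriented) in $\mathbb T$ that occupy at least one vertex in the plane $x=0$. The length of a polygon is its number of edges and its span is the maximal $x$-coordinate of its vertices. Let $\mathcal P^*_{\mathbb T}$ be the set of $\pi\in\mathcal P_{\mathbb T}$, of span $s\ge 2$, such that the only edge of $\pi$ in the plane $x=0$ joins $(0,0,0)$ and $(0,1,0)$, the only edge of $\pi$ in the plane $x=s$ joins $(s,0,0)$ and $(s,1,0)$, and $\pi$ has no edge in the plane $x=s-1$. Let $q^*_{\mathbb T,s}(n)$ be the number of polygons in $\mathcal P^*_{\mathbb T}$ of span $s$ and length $n$, and for real $z$ let $$Q^*_{\mathbb T,s}(z)=\sum_n q^*_{\mathbb T,s}(n)\,e^{zn},\qquad \mathcal G^*_{\mathbb T}(z)=\lim_{s\to\infty}\frac1s\log Q^*_{\mathbb T,s}(z).$$ A 1-block of $\mathbb T$ is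 the part of a polygon $\pi\in\mathcal P_{\mathbb T}$ lying between $x=k-\frac12$ and $x=k+\frac12$, for an integer $k$ such that $\pi$ has a vertex in the plane $x=k$; its length is the number of its edges (in the plane $x=k$) plus half the number of its half-edges (in the $x$-direction). For $s\ge1$, an $s$-block is a sequence of $s$ consecutive 1-blocks of one polygon of $\mathcal P_{\mathbb T}$, considered up to translation in the $x$-direction; it is full if each of its 1-blocks has length $W$. Let $b^{\mathrm F}_{\mathbb T,s}$ be the number of full $s$-blocks and $$\beta^{\mathrm F}_{\mathbb T}=\lim_{s\to\infty}\frac1s\log b^{\mathrm F}_{\mathbb T,s}.$$ Then the limit defining $\mathcal G^*_{\mathbb T}(z)$ exists and is finite for every real $z$, the limit defining $\beta^{\mathrm F}_{\mathbb T}$ exists and is finite, and $$\lim_{z\to\infty}\left(\mathcal G^*_{\mathbb T}(z)-Wz\right)=\beta^{\mathrm F}_{\mathbb T}.$$ -/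

import Mathlib

open Filter Topology

namespace TubePolygon

/-- Vertices `(x, y, z)` of the cubic lattice `ℤ³`. -/
abbrev Point : Type := ℤ × ℤ × ℤ

/-- The cubic lattice graph: two points are adjacent when they are at distance `1`. -/
def cubicLattice : SimpleGraph Point where
  Adj p q := |p.1 - q.1| + |p.2.1 - q.2.1| + |p.2.2 - q.2.2| = 1
  symm := ⟨fun p q h => by
    rw [abs_sub_comm q.1, abs_sub_comm q.2.1, abs_sub_comm q.2.2]; exact h⟩
  loopless := ⟨fun p h => by simp at h⟩

/-- The semi-infinite tube `{(x, y, z) : x ≥ 0, 0 ≤ y ≤ L, 0 ≤ z ≤ M}`. -/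
def tube (L M : ℕ) : Set Point :=
  {p | 0 ≤ p.1 ∧ 0 ≤ p.2.1 ∧ p.2.1 ≤ L ∧ 0 ≤ p.2.2 ∧ p.2.2 ≤ M}

/-- `W = (L + 1)(M + 1)`, the number of vertices of the tube in a plane `x = i ≥ 0`. -/
def W (L M : ℕ) : ℕ := (L + 1) * (M + 1)

/-- A self-avoiding polygon of the cubic lattice, given by its set of edges: the edge set of a
cycle of the lattice graph (unrooted and unoriented). Its length is `E.card`. -/
def IsPolygon (E : Finset (Sym2 Point)) : Prop :=
  ∃ (v : Point) (w : cubicLattice.Walk v v), w.IsCycle ∧ w.edges.toFinset = E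

/-- The vertices occupied by a set of edges. -/
def vertices (E : Finset (Sym2 Point)) : Set Point := {p | ∃ e ∈ E, p ∈ e}

/-- The set `𝒫_𝕋` of self-avoiding polygons in the tube that occupy at least one vertex
in the plane `x = 0`. -/
def tubePolygons (L M : ℕ) : Set (Finset (Sym2 Point)) :=
  {E | IsPolygon E ∧ vertices E ⊆ tube L M ∧ ∃ p ∈ vertices E, p.1 = 0}

/-- `E` has span `s`: the maximal `x`-coordinate reached by any of its vertices is `s`. -/
def HasSpan (E : Finset (Sym2 Point)) (s : ℕ) : Prop :=
  IsGreatest ((fun p : Point => p.1) '' vertices E) (s : ℤ)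

/-- The edges of `E` that lie in the plane `x = k`. -/
def edgesInPlane (E : Finset (Sym2 Point)) (k : ℤ) : Set (Sym2 Point) :=
  {e | e ∈ E ∧ ∀ p ∈ e, p.1 = k}

/-- The polygons of span `s` in the class `𝒫*_𝕋`: the span is at least `2`, the only edge in the
plane `x = 0` is `(0,0,0)-(0,1,0)`, the only edge in the plane `x = s` is `(s,0,0)-(s,1,0)`, and
there is no edge in the plane `x = s - 1`. -/
def starPolygons (L M s : ℕ) : Set (Finset (Sym2 Point)) :=
  {E | E ∈ tubePolygons L M ∧ HasSpan E s ∧ 2 ≤ s ∧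
    edgesInPlane E 0 = {s((0, 0, 0), (0, 1, 0))} ∧
    edgesInPlane E s = {s(((s : ℤ), 0, 0), ((s : ℤ), 1, 0))} ∧
    edgesInPlane E ((s : ℤ) - 1) = ∅}

/-- `q*_{𝕋,s}(n)`: the number of polygons in `𝒫*_𝕋` with span `s` and length `n`. -/
noncomputable def qStar (L M s n : ℕ) : ℕ :=
  {E | E ∈ starPolygons L M s ∧ E.card = n}.ncard

/-- The partition function `Q*_{𝕋,s}(z) = ∑ₙ q*_{𝕋,s}(n) e^{zn}`, in which the span is the size
and the length is the energy. The sum has finitely many nonzero terms. -/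
noncomputable def QStar (L M s : ℕ) (z : ℝ) : ℝ :=
  ∑' n : ℕ, (qStar L M s n : ℝ) * Real.exp (z * n)

/-- The dual free energy `𝒢*_𝕋(z) = lim_{s → ∞} (1/s) log Q*_{𝕋,s}(z)`. -/
noncomputable def dualFreeEnergy (L M : ℕ) (z : ℝ) : ℝ :=
  limUnder atTop fun s : ℕ => (1 / (s : ℝ)) * Real.log (QStar L M s z)

/-- The data of a 1-block, up to translation in the `x`-direction: the hinge edges, lying in a
plane `x = k`, and the half-edges of the two adjacent half-sections `[k - 1/2, k]` and
`[k, k + 1/2]`, all recorded by their `(y, z)`-coordinates. (The hinge vertices are the endpoints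
of these edges and half-edges.) -/
@[ext]
structure OneBlock where
  hinge : Set (Sym2 (ℤ × ℤ))
  left : Set (ℤ × ℤ)
  right : Set (ℤ × ℤ)

/-- The part of the polygon `E` between `x = k - 1/2` and `x = k + 1/2`. -/
def oneBlockAt (E : Finset (Sym2 Point)) (k : ℤ) : OneBlock where
  hinge := {e | e.map (fun u => ((k, u) : Point)) ∈ E}
  left := {u | s(((k - 1, u) : Point), ((k, u) : Point)) ∈ E}
  right := {u | s(((k, u) : Point), ((k + 1, u) : Point)) ∈ E}

/-- The length of a 1-block: each hinge edge counts `1`, each half-edge counts `1/2`. -/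
noncomputable def OneBlock.length (b : OneBlock) : ℚ :=
  b.hinge.ncard + (b.left.ncard + b.right.ncard : ℚ) / 2

/-- The `s`-blocks of the tube, up to translation in the `x`-direction: the sequences of `s`
consecutive 1-blocks, with non-empty hinges, that occur in some polygon of the tube. -/
def blocks (L M s : ℕ) : Set (Fin s → OneBlock) :=
  {b | ∃ E ∈ tubePolygons L M, ∃ k : ℤ, ∀ i : Fin s,
    (∃ p ∈ vertices E, p.1 = k + (i : ℕ)) ∧ b i = oneBlockAt E (k + (i : ℕ))}

/-- The full `s`-blocks: all the constituent 1-blocks have length `W`. -/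
def fullBlocks (L M s : ℕ) : Set (Fin s → OneBlock) :=
  {b | b ∈ blocks L M s ∧ ∀ i, (b i).length = W L M}

/-- The growth rate of full blocks, `β^F_𝕋 = lim_{s → ∞} (1/s) log b^F_{𝕋,s}`. -/
noncomputable def betaFull (L M : ℕ) : ℝ :=
  limUnder atTop fun s : ℕ => (1 / (s : ℝ)) * Real.log ((fullBlocks L M s).ncard : ℝ)

end TubePolygon

namespace TubePolygon

open Relation

lemma mem_vertices {E : Finset (Sym2 Point)} {p : Point} :
    p ∈ vertices E ↔ ∃ q, s(p, q) ∈ E := by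
  constructor
  · rintro ⟨e, he, hp⟩
    obtain ⟨q, rfl⟩ := Sym2.mem_iff_exists.1 hp
    exact ⟨q, he⟩
  · rintro ⟨q, h⟩
    exact ⟨_, h, Sym2.mem_mk_left p q⟩

lemma left_mem_vertices {E : Finset (Sym2 Point)} {p q : Point} (h : s(p, q) ∈ E) :
    p ∈ vertices E := mem_vertices.2 ⟨q, h⟩

lemma right_mem_vertices {E : Finset (Sym2 Point)} {p q : Point} (h : s(p, q) ∈ E) :
    q ∈ vertices E := left_mem_vertices (Sym2.eq_swap ▸ h)

/-- Connectedness by edges of `E`. -/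
def Linked (E : Finset (Sym2 Point)) : Point → Point → Prop :=
  ReflTransGen fun p q => s(p, q) ∈ E

lemma Linked.symm {E : Finset (Sym2 Point)} {p q : Point} (h : Linked E p q) : Linked E q p :=
  have : Std.Symm fun p q => s(p, q) ∈ E := ⟨fun _ _ h => Sym2.eq_swap ▸ h⟩
  ReflTransGen.stdSymm.symm _ _ h

lemma Linked.trans {E : Finset (Sym2 Point)} {p q r : Point} (h : Linked E p q)
    (h' : Linked E q r) : Linked E p r := ReflTransGen.trans h h'

lemma Linked.mono {E F : Finset (Sym2 Point)} (hEF : E ⊆ F) {p q : Point} (h : Linked E p q) :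
    Linked F p q := ReflTransGen.mono (fun _ _ h => hEF h) _ _ h

lemma linked_of_walk {G : SimpleGraph Point} {E : Finset (Sym2 Point)} {p q : Point}
    (w : G.Walk p q) (h : ∀ e ∈ w.edges, e ∈ E) : Linked E p q := by
  induction w with
  | nil => exact ReflTransGen.refl
  | cons hadj w ih =>
    simp only [SimpleGraph.Walk.edges_cons, List.mem_cons, forall_eq_or_imp] at h
    exact ReflTransGen.head h.1 (ih h.2)

/-- The edge sets of cycles, described by degrees and connectedness. -/
structure IsLoop (E : Finset (Sym2 Point)) : Prop where
  lattice : ∀ ⦃p q⦄, s(p, q) ∈ E → cubicLattice.Adj p q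
  nonempty : E.Nonempty
  degree : ∀ p ∈ vertices E, {q | s(p, q) ∈ E}.ncard = 2
  linked : ∀ p ∈ vertices E, ∀ q ∈ vertices E, Linked E p q

lemma IsPolygon.isLoop {E : Finset (Sym2 Point)} (h : IsPolygon E) : IsLoop E := by
  obtain ⟨v, w, hw, rfl⟩ := h
  have hsupp : ∀ p, p ∈ vertices w.edges.toFinset → p ∈ w.support := by
    intro p hp
    obtain ⟨q, hq⟩ := mem_vertices.1 hp
    exact w.fst_mem_support_of_mem_edges (List.mem_toFinset.1 hq)
  have hl : ∀ p ∈ vertices w.edges.toFinset, Linked w.edges.toFinset v p := by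
    intro p hp
    exact linked_of_walk (w.takeUntil p (hsupp p hp)) fun e he =>
      List.mem_toFinset.2 (w.edges_takeUntil_subset_edges _ he)
  refine ⟨?_, ?_, ?_, ?_⟩
  · intro p q h
    exact w.adj_of_mem_edges (List.mem_toFinset.1 h)
  · rw [List.toFinset_nonempty_iff]
    intro h
    exact hw.not_nil (SimpleGraph.Walk.edges_eq_nil.1 h)
  · intro p hp
    rw [← hw.ncard_neighborSet_toSubgraph_eq_two (hsupp p hp)]
    congr 1
    ext q
    simp [SimpleGraph.Walk.adj_toSubgraph_iff_mem_edges]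
  · intro p hp q hq
    exact (hl p hp).symm.trans (hl q hq)

lemma IsLoop.isPolygon {E : Finset (Sym2 Point)} (h : IsLoop E) : IsPolygon E := by
  set G := SimpleGraph.fromEdgeSet (E : Set (Sym2 Point)) with hG
  have hadj : ∀ {p q}, G.Adj p q ↔ s(p, q) ∈ E := by
    intro p q
    simp only [hG, SimpleGraph.fromEdgeSet_adj, Finset.mem_coe, and_iff_left_iff_imp]
    exact fun hpq => (h.lattice hpq).ne
  have hle : G ≤ cubicLattice := fun p q hpq => h.lattice (hadj.1 hpq)
  have hfin : Finite G.edgeSet := by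
    refine Set.Finite.subset E.finite_toSet fun e => ?_
    induction e with | _ p q => exact fun he => hadj.1 he
  have hnot : ¬ G.IsAcyclic := by
    intro hac
    obtain ⟨u, v, p, hp, hmax⟩ := SimpleGraph.Walk.exists_isPath_forall_isPath_length_le_length G
    obtain ⟨e, he⟩ := h.nonempty
    induction e with | _ a b
    have hab := hadj.2 he
    have hlen := hmax a b (SimpleGraph.Walk.cons hab .nil) (by simp [hab.ne])
    have hnil : ¬ p.Nil := by
      rw [← SimpleGraph.Walk.length_eq_zero_iff]
      simp only [SimpleGraph.Walk.length_cons, SimpleGraph.Walk.length_nil] at hlen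
      lia
    have huniq : {q | s(u, q) ∈ E} ⊆ {p.snd} := by
      intro w hw
      have hw' : G.Adj u w := hadj.2 hw
      refine hac.eq_snd_of_adj_start hp hw' ?_
      by_contra hns
      have := hmax _ _ _ (hp.cons hns (h := hw'.symm))
      simp at this
    have h2 := h.degree u (left_mem_vertices (hadj.1 (p.adj_snd hnil)))
    have := Set.ncard_le_ncard huniq
    simp [h2] at this
  simp only [SimpleGraph.IsAcyclic, not_forall, not_not] at hnot
  obtain ⟨v, c, hc⟩ := hnot
  have hsub : ∀ e ∈ c.edges, e ∈ E := by
    intro e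
    induction e with | _ p q => exact fun he => hadj.1 (c.adj_of_mem_edges he)
  have hclosed : ∀ p ∈ c.support, ∀ q, s(p, q) ∈ E → s(p, q) ∈ c.edges := by
    intro p hp q hq
    have h2 := hc.ncard_neighborSet_toSubgraph_eq_two hp
    have hd := h.degree p (left_mem_vertices hq)
    have hsub' : c.toSubgraph.neighborSet p ⊆ {q | s(p, q) ∈ E} := by
      intro r hr
      exact hsub _ (SimpleGraph.Walk.adj_toSubgraph_iff_mem_edges.1 hr)
    have heq := Set.eq_of_subset_of_ncard_le hsub' (by rw [hd, h2])
      (Set.finite_of_ncard_ne_zero (by rw [hd]; decide))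
    have : q ∈ c.toSubgraph.neighborSet p := heq ▸ hq
    exact SimpleGraph.Walk.adj_toSubgraph_iff_mem_edges.1 this
  have hv : v ∈ vertices E := left_mem_vertices (hadj.1 (c.adj_snd hc.not_nil))
  have hall : ∀ p, Linked E v p → p ∈ c.support := by
    intro p hp
    induction hp with
    | refl => simp
    | tail _ hbc ih => exact c.snd_mem_support_of_mem_edges (hclosed _ ih _ hbc)
  refine ⟨v, c.mapLe hle, hc.mapLe hle, ?_⟩
  ext e
  simp only [SimpleGraph.Walk.edges_mapLe_eq_edges, List.mem_toFinset]
  refine ⟨hsub e, ?_⟩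
  induction e with | _ p q
  exact fun he => hclosed p (hall p (h.linked v hv p (left_mem_vertices he))) q he

/-- A polygon through an edge is a path closed by this edge. -/
lemma IsPolygon.exists_path {E : Finset (Sym2 Point)} (h : IsPolygon E) {a b : Point}
    (hab : s(a, b) ∈ E) :
    ∃ p : cubicLattice.Walk a b, p.IsPath ∧ p.edges.toFinset = E.erase s(a, b) := by
  obtain ⟨v, w, hw, rfl⟩ := h
  have hab' : s(a, b) ∈ w.edges := List.mem_toFinset.1 hab
  have key : ∀ (w : cubicLattice.Walk a a), w.IsCycle → w.snd = b →
      ∃ p : cubicLattice.Walk b a, p.IsPath ∧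
        p.edges.toFinset = w.edges.toFinset.erase s(a, b) := by
    intro w hw hb
    cases w with
    | nil => exact absurd hw (by simp)
    | cons hadj q =>
      simp only [SimpleGraph.Walk.snd_cons] at hb
      subst hb
      rw [SimpleGraph.Walk.cons_isCycle_iff] at hw
      refine ⟨q, hw.1, ?_⟩
      rw [SimpleGraph.Walk.edges_cons, List.toFinset_cons, Finset.erase_insert]
      simpa using hw.2
  have ha := w.fst_mem_support_of_mem_edges hab'
  have hc := hw.rotate ha
  have hperm : (w.rotate a ha).edges.toFinset = w.edges.toFinset := by
    ext e
    simp [(w.rotate_edges a ha).mem_iff]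
  have hmem : b ∈ (w.rotate a ha).toSubgraph.neighborSet a := by
    rw [SimpleGraph.Subgraph.mem_neighborSet, SimpleGraph.Walk.adj_toSubgraph_iff_mem_edges]
    exact (w.rotate_edges a ha).mem_iff.2 hab'
  rw [hc.neighborSet_toSubgraph_endpoint] at hmem
  rcases hmem with hb | hb
  · obtain ⟨p, hp, hpe⟩ := key _ hc hb.symm
    refine ⟨p.reverse, hp.reverse, ?_⟩
    rw [← hperm, ← hpe]
    ext e
    simp
  · obtain ⟨p, hp, hpe⟩ := key _ hc.reverse (by simpa using hb.symm)
    refine ⟨p.reverse, hp.reverse, ?_⟩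
    rw [← hperm]
    ext e
    have := Finset.ext_iff.1 hpe e
    simpa using this

/-- Two polygons with exactly one edge in common, and no other common vertices, merge into one
after the deletion of this edge. -/
theorem IsPolygon.merge {E F : Finset (Sym2 Point)} (hE : IsPolygon E) (hF : IsPolygon F)
    {a b : Point} (haE : s(a, b) ∈ E) (haF : s(a, b) ∈ F)
    (hV : ∀ p ∈ vertices E, p ∈ vertices F → p = a ∨ p = b) :
    IsPolygon ((E ∪ F).erase s(a, b)) := by
  obtain ⟨p, hp, hpe⟩ := hE.exists_path haE
  obtain ⟨q, hq, hqe⟩ := hF.exists_path (a := b) (b := a) (Sym2.eq_swap ▸ haF)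
  have hab : a ≠ b := (hE.isLoop.lattice haE).ne
  have hpl : 1 < p.length := by
    by_contra hlt
    have hmem : s(a, b) ∉ p.edges := by
      rw [← List.mem_toFinset, hpe]
      simp
    cases p with
    | nil => exact hab rfl
    | cons h r =>
      cases r with
      | nil => simp at hmem
      | cons h' r' => simp at hlt
  have hsp : ∀ x ∈ p.support, x ∈ vertices E := by
    intro x hx
    obtain ⟨e, he, hxe⟩ := (SimpleGraph.Walk.mem_support_iff_exists_mem_edges_of_not_nil
      (by intro hn; have := SimpleGraph.Walk.length_eq_zero_iff.2 hn; lia)).1 hx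
    rw [← List.mem_toFinset, hpe] at he
    exact ⟨e, Finset.mem_of_mem_erase he, hxe⟩
  have hsq : ∀ x ∈ q.support, x ∈ vertices F := by
    intro x hx
    obtain ⟨e, he, hxe⟩ := (SimpleGraph.Walk.mem_support_iff_exists_mem_edges_of_not_nil
      (fun hn => hab hn.eq.symm)).1 hx
    rw [← List.mem_toFinset, hqe] at he
    exact ⟨e, Finset.mem_of_mem_erase he, hxe⟩
  refine ⟨a, p.append q, hp.isCycle_append hq ?_ (Or.inl hpl), ?_⟩
  · intro x hxp hxq
    have hpn := hp.support_nodup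
    have hqn := hq.support_nodup
    rw [← SimpleGraph.Walk.cons_tail_support, List.nodup_cons] at hpn hqn
    rcases hV x (hsp x (List.mem_of_mem_tail hxp)) (hsq x (List.mem_of_mem_tail hxq)) with rfl | rfl
    · exact hpn.1 hxp
    · exact hqn.1 hxq
  · rw [SimpleGraph.Walk.edges_append, List.toFinset_append, hpe, hqe, Sym2.eq_swap (a := b),
      Finset.erase_union_distrib]

/-- The unit square with corners `a, b, c, d`. -/
def square (a b c d : Point) : Finset (Sym2 Point) := {s(a, b), s(b, c), s(c, d), s(d, a)}

lemma isPolygon_square {a b c d : Point} (hab : cubicLattice.Adj a b) (hbc : cubicLattice.Adj b c)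
    (hcd : cubicLattice.Adj c d) (hda : cubicLattice.Adj d a) (hac : a ≠ c) (hbd : b ≠ d) :
    IsPolygon (square a b c d) := by
  refine ⟨a, .cons hab (.cons hbc (.cons hcd (.cons hda .nil))), ?_, ?_⟩
  · rw [SimpleGraph.Walk.cons_isCycle_iff]
    have h1 := hab.ne
    have h2 := hbc.ne
    have h3 := hcd.ne
    have h4 := hda.ne
    simp only [SimpleGraph.Walk.cons_isPath_iff, SimpleGraph.Walk.IsPath.nil,
      SimpleGraph.Walk.support_cons, SimpleGraph.Walk.support_nil, List.mem_cons,
      SimpleGraph.Walk.edges_cons, SimpleGraph.Walk.edges_nil, Sym2.eq_iff]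
    grind
  · ext e
    simp [square]

lemma vertices_square {a b c d p : Point} :
    p ∈ vertices (square a b c d) ↔ p = a ∨ p = b ∨ p = c ∨ p = d := by
  simp only [vertices, square, Finset.mem_insert, Finset.mem_singleton, Set.mem_ofPred_eq]
  constructor
  · rintro ⟨e, rfl | rfl | rfl | rfl, h⟩ <;> simp only [Sym2.mem_iff] at h <;> tauto
  · rintro (rfl | rfl | rfl | rfl)
    · exact ⟨s(p, b), by simp⟩
    · exact ⟨s(a, p), by simp⟩
    · exact ⟨s(b, p), by simp⟩
    · exact ⟨s(c, p), by simp⟩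

/-- The image of a polygon by an automorphism of the lattice is a polygon. -/
lemma IsPolygon.image {E : Finset (Sym2 Point)} (h : IsPolygon E) (f : Point ≃ Point)
    (hf : ∀ p q, cubicLattice.Adj p q → cubicLattice.Adj (f p) (f q)) :
    IsPolygon (E.image (Sym2.map f)) := by
  obtain ⟨v, w, hw, rfl⟩ := h
  let φ : cubicLattice →g cubicLattice := ⟨f, fun {p q} h => hf p q h⟩
  refine ⟨f v, w.map φ, hw.map (f := φ) f.injective, ?_⟩
  ext e
  simp [SimpleGraph.Walk.edges_map, φ]

lemma mem_image_map {E : Finset (Sym2 Point)} {f : Point ≃ Point} {e : Sym2 Point} :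
    e ∈ E.image (Sym2.map f) ↔ e.map f.symm ∈ E := by
  rw [Finset.mem_image]
  constructor
  · rintro ⟨e, he, rfl⟩
    simpa [Sym2.map_map] using he
  · intro h
    exact ⟨_, h, by simp [Sym2.map_map]⟩

lemma mem_vertices_image {E : Finset (Sym2 Point)} {f : Point ≃ Point} {p : Point} :
    p ∈ vertices (E.image (Sym2.map f)) ↔ f.symm p ∈ vertices E := by
  simp only [mem_vertices, mem_image_map, Sym2.map_mk]
  exact ⟨fun ⟨q, hq⟩ => ⟨_, hq⟩, fun ⟨q, hq⟩ => ⟨f q, by simpa using hq⟩⟩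

/-- The vertices of a finite set of edges, as a finite set. -/
def vertexFinset (E : Finset (Sym2 Point)) : Finset Point := E.biUnion Sym2.toFinset

lemma mem_vertexFinset {E : Finset (Sym2 Point)} {p : Point} :
    p ∈ vertexFinset E ↔ p ∈ vertices E := by
  simp [vertexFinset, vertices]

/-- The occupied points of a plane `x = k`. -/
def occupied (E : Finset (Sym2 Point)) (k : ℤ) : Set (ℤ × ℤ) := {u | ((k, u) : Point) ∈ vertices E}

lemma adj_iff {p q : Point} : cubicLattice.Adj p q ↔
    |p.1 - q.1| + |p.2.1 - q.2.1| + |p.2.2 - q.2.2| = 1 := Iff.rfl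

lemma adj_cases {p q : Point} (h : cubicLattice.Adj p q) :
    p.1 = q.1 ∨ (p.2 = q.2 ∧ (p.1 = q.1 + 1 ∨ q.1 = p.1 + 1)) := by
  rw [adj_iff] at h
  rw [Prod.ext_iff]
  grind

lemma IsLoop.card_incident {E : Finset (Sym2 Point)} (h : IsLoop E) {p : Point}
    (hp : p ∈ vertices E) : (E.filter fun e => p ∈ e).card = 2 := by
  rw [← h.degree p hp, ← Set.ncard_coe_finset]
  have hinj : Function.Injective fun q => s(p, q) := fun q r hqr => Sym2.congr_right.1 hqr
  rw [← Set.ncard_image_of_injective _ hinj]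
  congr 1
  ext e
  simp only [Finset.coe_filter, Set.mem_ofPred_eq, Set.mem_image]
  constructor
  · rintro ⟨he, hpe⟩
    obtain ⟨q, rfl⟩ := Sym2.mem_iff_exists.1 hpe
    exact ⟨q, he, rfl⟩
  · rintro ⟨q, hq, rfl⟩
    exact ⟨hq, Sym2.mem_mk_left _ _⟩

/-- Double counting of the incidences between edges and vertices of a set `S`. -/
lemma IsLoop.two_mul_card {E : Finset (Sym2 Point)} (h : IsLoop E) {S : Finset Point}
    (hS : ∀ p ∈ S, p ∈ vertices E) :
    2 * S.card = ∑ e ∈ E, (S.filter fun p => p ∈ e).card := by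
  have := Finset.sum_card_bipartiteAbove_eq_sum_card_bipartiteBelow
    (s := S) (t := E) (fun p e => p ∈ e)
  simp only [Finset.bipartiteAbove, Finset.bipartiteBelow] at this
  rw [← this, Finset.sum_congr rfl fun p hp => h.card_incident (hS p hp), Finset.sum_const,
    smul_eq_mul, mul_comm]

lemma IsLoop.card_eq {E : Finset (Sym2 Point)} (h : IsLoop E) : E.card = (vertexFinset E).card := by
  have h1 := h.two_mul_card (S := vertexFinset E) fun p hp => mem_vertexFinset.1 hp
  have h2 : ∀ e ∈ E, ((vertexFinset E).filter fun p => p ∈ e).card = 2 := by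
    intro e he
    induction e with | _ p q
    have : (vertexFinset E).filter (fun r => r ∈ s(p, q)) = {p, q} := by
      ext r
      simp only [Finset.mem_filter, mem_vertexFinset, Sym2.mem_iff, Finset.mem_insert,
        Finset.mem_singleton, and_iff_right_iff_imp]
      rintro (rfl | rfl)
      exacts [left_mem_vertices he, right_mem_vertices he]
    rw [this, Finset.card_pair (h.lattice he).ne]
  rw [Finset.sum_congr rfl h2, Finset.sum_const, smul_eq_mul] at h1
  lia

lemma ncard_edge_preimage {α : Type*} {E : Finset (Sym2 Point)} {f : α → Sym2 Point}
    (hf : Function.Injective f) [DecidablePred fun e => e ∈ Set.range f] :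
    {u | f u ∈ E}.ncard = ∑ e ∈ E, if e ∈ Set.range f then 1 else 0 := by
  rw [← Finset.card_filter, ← Set.ncard_coe_finset, ← Set.ncard_image_of_injective _ hf]
  congr 1
  ext e
  simp only [Set.mem_image, Set.mem_ofPred_eq, Finset.coe_filter, Set.mem_range]
  constructor
  · rintro ⟨u, hu, rfl⟩
    exact ⟨hu, u, rfl⟩
  · rintro ⟨he, u, rfl⟩
    exact ⟨u, he, rfl⟩

lemma ncard_occupied (E : Finset (Sym2 Point)) (k : ℤ) :
    (occupied E k).ncard = ((vertexFinset E).filter fun p => p.1 = k).card := by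
  have hinj : Function.Injective fun u => ((k, u) : Point) := fun u v h => (Prod.ext_iff.1 h).2
  rw [← Set.ncard_image_of_injective _ hinj, ← Set.ncard_coe_finset]
  congr 1
  ext ⟨x, u⟩
  simp only [Set.mem_image, Finset.coe_filter, mem_vertexFinset, Set.mem_ofPred_eq, occupied,
    Prod.mk.injEq]
  constructor
  · rintro ⟨u, hu, rfl, rfl⟩
    exact ⟨hu, rfl⟩
  · rintro ⟨hu, rfl⟩
    exact ⟨u, hu, rfl, rfl⟩

open Classical in
/-- The length of a 1-block of a polygon is the number of its vertices. -/
theorem IsLoop.length_oneBlockAt {E : Finset (Sym2 Point)} (h : IsLoop E) (k : ℤ) :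
    (oneBlockAt E k).length = (occupied E k).ncard := by
  set S := (vertexFinset E).filter fun p => p.1 = k with hS
  have h1 := h.two_mul_card (S := S) fun p hp => mem_vertexFinset.1 (Finset.mem_filter.1 hp).1
  have hi : Function.Injective fun u : ℤ × ℤ => ((k, u) : Point) :=
    fun u v h => (Prod.ext_iff.1 h).2
  have hh : (oneBlockAt E k).hinge.ncard = _ := ncard_edge_preimage (Sym2.map.injective hi)
  have hl : (oneBlockAt E k).left.ncard = _ :=
    ncard_edge_preimage (E := E) (f := fun u : ℤ × ℤ => s(((k - 1, u) : Point), (k, u)))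
      (fun u v huv => by simpa [Sym2.eq_iff] using huv)
  have hr : (oneBlockAt E k).right.ncard = _ :=
    ncard_edge_preimage (E := E) (f := fun u : ℤ × ℤ => s(((k, u) : Point), (k + 1, u)))
      (fun u v huv => by simpa [Sym2.eq_iff] using huv)
  have key : 2 * S.card = 2 * (oneBlockAt E k).hinge.ncard + (oneBlockAt E k).left.ncard +
      (oneBlockAt E k).right.ncard := by
    rw [h1, hh, hl, hr, Finset.mul_sum, ← Finset.sum_add_distrib, ← Finset.sum_add_distrib]
    refine Finset.sum_congr rfl fun e he => ?_
    induction e with | _ p q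
    have hadj := h.lattice he
    have hcard : (S.filter fun r => r ∈ s(p, q)).card =
        (if p.1 = k then 1 else 0) + (if q.1 = k then 1 else 0) := by
      have : S.filter (fun r => r ∈ s(p, q)) = ({p, q} : Finset Point).filter fun r => r.1 = k := by
        ext r
        simp only [hS, Finset.mem_filter, mem_vertexFinset, Sym2.mem_iff, Finset.mem_insert,
          Finset.mem_singleton]
        constructor
        · tauto
        · rintro ⟨rfl | rfl, hk⟩
          · exact ⟨⟨left_mem_vertices he, hk⟩, Or.inl rfl⟩
          · exact ⟨⟨right_mem_vertices he, hk⟩, Or.inr rfl⟩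
      rw [this, Finset.card_filter, Finset.sum_pair hadj.ne]
    rw [hcard]
    have e1 : s(p, q) ∈ Set.range (Sym2.map fun u : ℤ × ℤ => ((k, u) : Point)) ↔
        p.1 = k ∧ q.1 = k := by
      constructor
      · rintro ⟨e, he⟩
        induction e with | _ u v
        rcases Sym2.eq_iff.1 he with ⟨rfl, rfl⟩ | ⟨rfl, rfl⟩ <;> simp
      · rintro ⟨h1, h2⟩
        exact ⟨s(p.2, q.2), by
          rw [Sym2.map_mk, show ((k, p.2) : Point) = p from Prod.ext h1.symm rfl,
            show ((k, q.2) : Point) = q from Prod.ext h2.symm rfl]⟩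
    have e2 : ∀ m : ℤ, s(p, q) ∈ Set.range (fun u : ℤ × ℤ => s(((m, u) : Point), (m + 1, u))) ↔
        (p.1 = m ∧ q.1 = m + 1) ∨ (q.1 = m ∧ p.1 = m + 1) := by
      intro m
      constructor
      · rintro ⟨u, hu⟩
        rcases Sym2.eq_iff.1 hu with ⟨rfl, rfl⟩ | ⟨rfl, rfl⟩ <;> simp
      · rcases p with ⟨x, u⟩
        rcases q with ⟨y, v⟩
        have hc := adj_cases hadj
        dsimp only at hc ⊢
        rintro (⟨rfl, rfl⟩ | ⟨rfl, rfl⟩)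
        · obtain rfl : u = v := by
            rcases hc with hc | hc
            · lia
            · exact hc.1
          exact ⟨u, rfl⟩
        · obtain rfl : u = v := by
            rcases hc with hc | hc
            · lia
            · exact hc.1
          exact ⟨u, Sym2.eq_swap⟩
    have e3 := e2 (k - 1)
    rw [sub_add_cancel] at e3
    rw [if_congr e1 rfl rfl, if_congr e3 rfl rfl, if_congr (e2 k) rfl rfl]
    have hc := adj_cases hadj
    split_ifs <;> grind
  rw [ncard_occupied, OneBlock.length]
  have : (2 * S.card : ℚ) = 2 * (oneBlockAt E k).hinge.ncard + (oneBlockAt E k).left.ncard +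
      (oneBlockAt E k).right.ncard := by exact_mod_cast key
  linarith

/-- The cross-section of the tube. -/
noncomputable def cross (L M : ℕ) : Finset (ℤ × ℤ) := Finset.Icc 0 (L : ℤ) ×ˢ Finset.Icc 0 (M : ℤ)

lemma mem_cross {L M : ℕ} {u : ℤ × ℤ} :
    u ∈ cross L M ↔ (0 ≤ u.1 ∧ u.1 ≤ L) ∧ 0 ≤ u.2 ∧ u.2 ≤ M := by
  simp [cross]

lemma card_cross (L M : ℕ) : (cross L M).card = W L M := by
  simp [cross, W]

lemma mem_tube {L M : ℕ} {p : Point} : p ∈ tube L M ↔ 0 ≤ p.1 ∧ p.2 ∈ cross L M := by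
  simp only [tube, Set.mem_ofPred_eq, mem_cross]
  tauto

lemma occupied_subset {L M : ℕ} {E : Finset (Sym2 Point)} (h : vertices E ⊆ tube L M) (k : ℤ) :
    occupied E k ⊆ cross L M := fun _ hu => (mem_tube.1 (h hu)).2

lemma ncard_occupied_le {L M : ℕ} {E : Finset (Sym2 Point)} (h : vertices E ⊆ tube L M) (k : ℤ) :
    (occupied E k).ncard ≤ W L M := by
  rw [← card_cross, ← Set.ncard_coe_finset]
  exact Set.ncard_le_ncard (occupied_subset h k) (Finset.finite_toSet _)

lemma length_oneBlockAt_le {L M : ℕ} {E : Finset (Sym2 Point)} (h : E ∈ tubePolygons L M) (k : ℤ) :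
    (oneBlockAt E k).length ≤ W L M := by
  rw [h.1.isLoop.length_oneBlockAt]
  exact_mod_cast ncard_occupied_le h.2.1 k

lemma length_oneBlockAt_eq_iff {L M : ℕ} {E : Finset (Sym2 Point)} (h : E ∈ tubePolygons L M)
    (k : ℤ) : (oneBlockAt E k).length = W L M ↔ occupied E k = cross L M := by
  rw [h.1.isLoop.length_oneBlockAt]
  norm_cast
  rw [← card_cross, ← Set.ncard_coe_finset]
  refine ⟨fun heq => Set.eq_of_subset_of_ncard_le (occupied_subset h.2.1 k) heq.ge
    (Finset.finite_toSet _), fun heq => by rw [heq]⟩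

/-- The number of edges is the sum of the lengths of the 1-blocks. -/
lemma card_eq_sum_length {L M s : ℕ} {E : Finset (Sym2 Point)} (h : E ∈ tubePolygons L M)
    (hs : HasSpan E s) :
    (E.card : ℚ) = ∑ i ∈ Finset.range (s + 1), (oneBlockAt E i).length := by
  simp_rw [h.1.isLoop.length_oneBlockAt, h.1.isLoop.card_eq, ncard_occupied]
  norm_cast
  rw [Finset.card_eq_sum_card_fiberwise (f := fun p => p.1.toNat) (t := Finset.range (s + 1))]
  · refine Finset.sum_congr rfl fun i _ => congrArg _ (Finset.filter_congr fun p hp => ?_)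
    have := (mem_tube.1 (h.2.1 (mem_vertexFinset.1 hp))).1
    lia
  · intro p hp
    have h1 := (mem_tube.1 (h.2.1 (mem_vertexFinset.1 hp))).1
    have h2 : p.1 ≤ s := hs.2 ⟨p, mem_vertexFinset.1 hp, rfl⟩
    simp only [Finset.coe_range, Set.mem_Iio]
    lia

/-- The possible 1-blocks in the tube. -/
noncomputable def crossBlocks (L M : ℕ) : Set OneBlock :=
  {b | b.hinge ⊆ ((cross L M).sym2 : Set (Sym2 (ℤ × ℤ))) ∧ b.left ⊆ cross L M ∧
    b.right ⊆ cross L M}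

lemma crossBlocks_finite (L M : ℕ) : (crossBlocks L M).Finite := by
  have h1 := (cross L M).sym2.finite_toSet.finite_subsets
  have h2 := (cross L M).finite_toSet.finite_subsets
  refine ((h1.prod (h2.prod h2)).image fun t => OneBlock.mk t.1 t.2.1 t.2.2).subset ?_
  rintro ⟨a, b, c⟩ h
  exact ⟨(a, b, c), ⟨h.1, h.2.1, h.2.2⟩, rfl⟩

lemma oneBlockAt_mem_crossBlocks {L M : ℕ} {E : Finset (Sym2 Point)}
    (h : vertices E ⊆ tube L M) (k : ℤ) : oneBlockAt E k ∈ crossBlocks L M := by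
  refine ⟨fun e he => ?_, fun u hu => ?_, fun u hu => ?_⟩
  · induction e with | _ u v
    simp only [oneBlockAt, Set.mem_ofPred_eq, Sym2.map_mk] at he
    simp only [Finset.mem_coe, Finset.mk_mem_sym2_iff]
    exact ⟨(mem_tube.1 (h (left_mem_vertices he))).2, (mem_tube.1 (h (right_mem_vertices he))).2⟩
  · exact (mem_tube.1 (h (right_mem_vertices hu))).2
  · exact (mem_tube.1 (h (left_mem_vertices hu))).2

lemma oneBlockAt_congr {E F : Finset (Sym2 Point)} {k l : ℤ}
    (h : ∀ p q : Point, (p.1 = 0 ∨ q.1 = 0) →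
      (s((p.1 + k, p.2), (q.1 + k, q.2)) ∈ E ↔ s((p.1 + l, p.2), (q.1 + l, q.2)) ∈ F)) :
    oneBlockAt E k = oneBlockAt F l := by
  ext e
  · induction e with | _ u v
    simpa [oneBlockAt] using h (0, u) (0, v) (Or.inl rfl)
  · have := h (-1, e) (0, e) (Or.inr rfl)
    simp only [zero_add, neg_add_eq_sub] at this
    exact this
  · have := h (0, e) (1, e) (Or.inl rfl)
    simp only [zero_add, add_comm (1 : ℤ)] at this
    exact this

/-- An edge with an endpoint in the plane `x = k` is visible in the 1-block at `k`. -/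
lemma mem_iff_of_oneBlockAt_eq {E F : Finset (Sym2 Point)} {k : ℤ}
    (hE : ∀ ⦃p q⦄, s(p, q) ∈ E → cubicLattice.Adj p q)
    (hF : ∀ ⦃p q⦄, s(p, q) ∈ F → cubicLattice.Adj p q)
    (h : oneBlockAt E k = oneBlockAt F k) {p q : Point} (hp : p.1 = k) :
    s(p, q) ∈ E ↔ s(p, q) ∈ F := by
  by_cases hadj : cubicLattice.Adj p q
  swap
  · exact ⟨fun h => absurd (hE h) hadj, fun h => absurd (hF h) hadj⟩
  rw [OneBlock.ext_iff] at h
  obtain ⟨h1, h2, h3⟩ := h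
  obtain ⟨x, u⟩ := p
  obtain ⟨y, v⟩ := q
  have hc := adj_cases hadj
  dsimp only at hp hc
  subst hp
  rcases hc with rfl | ⟨rfl, rfl | rfl⟩
  · simpa [oneBlockAt] using Set.ext_iff.1 h1 s(u, v)
  · have := Set.ext_iff.1 h2 u
    simp only [oneBlockAt, Set.mem_ofPred_eq, add_sub_cancel_right] at this
    rwa [Sym2.eq_swap]
  · exact Set.ext_iff.1 h3 u

lemma tubePolygons_finite (L M s : ℕ) : {E | E ∈ tubePolygons L M ∧ HasSpan E s}.Finite := by
  refine ((Finset.Icc (0 : ℤ) s ×ˢ cross L M).sym2.powerset.finite_toSet).subset ?_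
  rintro E ⟨hE, hs⟩
  have hmem : ∀ p ∈ vertices E, p ∈ Finset.Icc (0 : ℤ) s ×ˢ cross L M := fun p hp => by
    have h1 := mem_tube.1 (hE.2.1 hp)
    have h2 : p.1 ≤ s := hs.2 ⟨p, hp, rfl⟩
    simp only [Finset.mem_product, Finset.mem_Icc]
    exact ⟨⟨h1.1, h2⟩, h1.2⟩
  simp only [Finset.coe_powerset, Set.mem_preimage, Set.mem_powerset_iff]
  intro e he
  induction e with | _ p q
  rw [Finset.mem_coe, Finset.mk_mem_sym2_iff]
  exact ⟨hmem p (left_mem_vertices he), hmem q (right_mem_vertices he)⟩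

lemma blocks_finite (L M s : ℕ) : (blocks L M s).Finite := by
  refine (Set.Finite.pi' fun _ : Fin s => crossBlocks_finite L M).subset ?_
  rintro b ⟨E, hE, k, hk⟩ i
  rw [(hk i).2]
  exact oneBlockAt_mem_crossBlocks hE.2.1 _

lemma fullBlocks_finite (L M s : ℕ) : (fullBlocks L M s).Finite :=
  (blocks_finite L M s).subset fun _ h => h.1

lemma length_le_of_mem_blocks {L M s : ℕ} {b : Fin s → OneBlock} (h : b ∈ blocks L M s)
    (i : Fin s) : (b i).length ≤ W L M := by
  obtain ⟨E, hE, k, hk⟩ := h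
  rw [(hk i).2]
  exact length_oneBlockAt_le hE _

lemma comp_mem_blocks {L M s n : ℕ} {b : Fin n → OneBlock} (h : b ∈ blocks L M n) (f : Fin s → Fin n)
    (r : ℕ) (hf : ∀ i, (f i : ℕ) = r + i) : b ∘ f ∈ blocks L M s := by
  obtain ⟨E, hE, k, hk⟩ := h
  refine ⟨E, hE, k + r, fun i => ?_⟩
  have := hk (f i)
  rw [hf, Nat.cast_add, ← add_assoc] at this
  exact this

lemma comp_mem_fullBlocks {L M s n : ℕ} {b : Fin n → OneBlock} (h : b ∈ fullBlocks L M n)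
    (f : Fin s → Fin n) (r : ℕ) (hf : ∀ i, (f i : ℕ) = r + i) : b ∘ f ∈ fullBlocks L M s :=
  ⟨comp_mem_blocks h.1 f r hf, fun i => h.2 (f i)⟩

/-- Cutting an `(s + t)`-block into an `s`-block and a `t`-block. -/
def cutBlock (s t : ℕ) (b : Fin (s + t) → OneBlock) : (Fin s → OneBlock) × (Fin t → OneBlock) :=
  (b ∘ Fin.castAdd t, b ∘ Fin.natAdd s)

lemma cutBlock_injective (s t : ℕ) : Function.Injective (cutBlock s t) := by
  intro b c h
  rw [cutBlock, cutBlock, Prod.mk.injEq] at h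
  funext i
  refine Fin.addCases (fun j => congrFun h.1 j) (fun j => congrFun h.2 j) i

lemma cutBlock_mem_blocks {L M s t : ℕ} {b : Fin (s + t) → OneBlock} (h : b ∈ blocks L M (s + t)) :
    cutBlock s t b ∈ blocks L M s ×ˢ blocks L M t :=
  ⟨comp_mem_blocks h _ 0 (by simp), comp_mem_blocks h _ s (by simp)⟩

lemma cutBlock_mem_fullBlocks {L M s t : ℕ} {b : Fin (s + t) → OneBlock}
    (h : b ∈ fullBlocks L M (s + t)) : cutBlock s t b ∈ fullBlocks L M s ×ˢ fullBlocks L M t :=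
  ⟨comp_mem_fullBlocks h _ 0 (by simp), comp_mem_fullBlocks h _ s (by simp)⟩

lemma ncard_fullBlocks_add_le (L M s t : ℕ) :
    (fullBlocks L M (s + t)).ncard ≤ (fullBlocks L M s).ncard * (fullBlocks L M t).ncard := by
  rw [← Set.ncard_prod]
  exact Set.ncard_le_ncard_of_injOn (cutBlock s t) (fun b hb => cutBlock_mem_fullBlocks hb)
    (cutBlock_injective s t).injOn ((fullBlocks_finite L M s).prod (fullBlocks_finite L M t))

/-- The growth rate of full blocks exists. -/
theorem tendsto_betaFull (L M : ℕ) :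
    Tendsto (fun s : ℕ => (1 / (s : ℝ)) * Real.log ((fullBlocks L M s).ncard : ℝ))
      atTop (𝓝 (betaFull L M)) := by
  set u : ℕ → ℝ := fun s => Real.log ((fullBlocks L M s).ncard : ℝ) with hu
  have hnn : ∀ s, 0 ≤ u s := fun s => Real.log_natCast_nonneg _
  have hsub : Subadditive u := by
    intro s t
    rcases Nat.eq_zero_or_pos (fullBlocks L M (s + t)).ncard with h0 | hpos
    · rw [hu]
      dsimp only
      rw [h0, Nat.cast_zero, Real.log_zero]
      exact add_nonneg (hnn s) (hnn t)
    · have hle := ncard_fullBlocks_add_le L M s t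
      have hprod : 0 < (fullBlocks L M s).ncard * (fullBlocks L M t).ncard := hpos.trans_le hle
      have h1 := Nat.pos_of_mul_pos_right hprod
      have h2 := Nat.pos_of_mul_pos_left hprod
      have h1' : ((fullBlocks L M s).ncard : ℝ) ≠ 0 := by positivity
      have h2' : ((fullBlocks L M t).ncard : ℝ) ≠ 0 := by positivity
      rw [hu]
      dsimp only
      rw [← Real.log_mul h1' h2']
      exact Real.log_le_log (by exact_mod_cast hpos) (by exact_mod_cast hle)
  have hlim := hsub.tendsto_lim ⟨0, by
    rintro _ ⟨n, rfl⟩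
    exact div_nonneg (hnn n) n.cast_nonneg⟩
  have : (fun s : ℕ => (1 / (s : ℝ)) * Real.log ((fullBlocks L M s).ncard : ℝ)) =
      fun s => u s / s := by
    funext s
    rw [one_div_mul_eq_div]
  have h2 := hlim
  rw [← this] at h2
  rw [betaFull, h2.limUnder_eq]
  exact h2

/-- The weight of a 1-block, which is `1` for a full one. -/
noncomputable def weight (L M : ℕ) (z : ℝ) (b : OneBlock) : ℝ :=
  Real.exp (z * ((b.length : ℚ) - W L M : ℝ))

lemma weight_pos (L M : ℕ) (z : ℝ) (b : OneBlock) : 0 < weight L M z b := Real.exp_pos _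

/-- The total weight of the `s`-blocks. -/
noncomputable def blockSum (L M s : ℕ) (z : ℝ) : ℝ :=
  ∑ b ∈ (blocks_finite L M s).toFinset, ∏ i, weight L M z (b i)

lemma sum_le_sum_of_injOn {ι κ : Type*} {A : Finset ι} {B : Finset κ} {f : ι → ℝ} {g : κ → ℝ}
    (φ : ι → κ) (hφ : ∀ a ∈ A, φ a ∈ B) (hinj : Set.InjOn φ A) (hfg : ∀ a ∈ A, f a ≤ g (φ a))
    (hg : ∀ b ∈ B, 0 ≤ g b) : ∑ a ∈ A, f a ≤ ∑ b ∈ B, g b := by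
  classical
  calc ∑ a ∈ A, f a ≤ ∑ a ∈ A, g (φ a) := Finset.sum_le_sum hfg
    _ = ∑ b ∈ A.image φ, g b := (Finset.sum_image hinj).symm
    _ ≤ ∑ b ∈ B, g b := Finset.sum_le_sum_of_subset_of_nonneg
      (Finset.image_subset_iff.2 hφ) fun b hb _ => hg b hb

lemma blockSum_nonneg (L M s : ℕ) (z : ℝ) : 0 ≤ blockSum L M s z :=
  Finset.sum_nonneg fun _ _ => Finset.prod_nonneg fun _ _ => (weight_pos L M z _).le

lemma blockSum_add_le (L M s t : ℕ) (z : ℝ) :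
    blockSum L M (s + t) z ≤ blockSum L M s z * blockSum L M t z := by
  rw [blockSum, blockSum, blockSum, Finset.sum_mul_sum, ← Finset.sum_product']
  refine sum_le_sum_of_injOn (cutBlock s t) (fun b hb => ?_) (cutBlock_injective s t).injOn
    (fun b _ => ?_) fun x _ => ?_
  · have := cutBlock_mem_blocks ((Set.Finite.mem_toFinset _).1 hb)
    simpa using this
  · rw [Fin.prod_univ_add]
    rfl
  · exact mul_nonneg (Finset.prod_nonneg fun _ _ => (weight_pos L M z _).le)
      (Finset.prod_nonneg fun _ _ => (weight_pos L M z _).le)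

lemma blockSum_mul_le (L M t m : ℕ) (z : ℝ) :
    blockSum L M ((m + 1) * t) z ≤ blockSum L M t z ^ (m + 1) := by
  induction m with
  | zero => simp
  | succ m ih =>
    rw [add_mul _ 1, one_mul, pow_succ]
    exact (blockSum_add_le L M _ t z).trans
      (mul_le_mul_of_nonneg_right ih (blockSum_nonneg L M t z))

lemma tendsto_blockSum (L M s : ℕ) :
    Tendsto (fun z => blockSum L M s z) atTop (𝓝 ((fullBlocks L M s).ncard : ℝ)) := by
  classical
  have h1 : ∀ b ∈ (blocks_finite L M s).toFinset, ∀ i : Fin s,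
      Tendsto (fun z => weight L M z (b i)) atTop
        (𝓝 (if (b i).length = W L M then (1 : ℝ) else 0)) := by
    intro b hb i
    have hle := length_le_of_mem_blocks ((Set.Finite.mem_toFinset _).1 hb) i
    split_ifs with hW
    · simp [weight, hW]
    · have hlt : (((b i).length : ℚ) : ℝ) - W L M < 0 := by
        have : (b i).length < W L M := lt_of_le_of_ne hle hW
        have : (((b i).length : ℚ) : ℝ) < ((W L M : ℚ) : ℝ) := by exact_mod_cast this
        push_cast at this
        linarith
      exact Real.tendsto_exp_atBot.comp (tendsto_id.atTop_mul_const_of_neg hlt)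
  have h2 : ((fullBlocks L M s).ncard : ℝ) = ∑ b ∈ (blocks_finite L M s).toFinset,
      ∏ i : Fin s, (if (b i).length = W L M then (1 : ℝ) else 0) := by
    simp_rw [Finset.prod_ite_zero, Finset.prod_const_one]
    rw [← Finset.sum_filter, Finset.sum_const, nsmul_eq_mul, mul_one, ← Set.ncard_coe_finset]
    congr 2
    ext b
    simp [fullBlocks]
  rw [h2]
  exact tendsto_finsetSum _ fun b hb => tendsto_finsetProd _ fun i _ => h1 b hb i

/-- A polygon meets every plane between two of its vertices. -/
lemma IsLoop.exists_mem_plane {E : Finset (Sym2 Point)} (h : IsLoop E) {p q : Point}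
    (hp : p ∈ vertices E) (hq : q ∈ vertices E) {k : ℤ} (hpk : p.1 ≤ k) (hkq : k ≤ q.1) :
    ∃ r ∈ vertices E, r.1 = k := by
  have key : ∀ q, Linked E p q → k ≤ q.1 → ∃ r ∈ vertices E, r.1 = k := by
    intro q hq
    induction hq with
    | refl => exact fun hk => ⟨p, hp, le_antisymm hpk hk⟩
    | @tail b c _ hbc ih =>
      intro hk
      by_cases hb : k ≤ b.1
      · exact ih hb
      · refine ⟨c, right_mem_vertices hbc, ?_⟩
        have := adj_cases (h.lattice hbc)
        lia
  exact key q (h.linked p hp q hq) hkq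

lemma oneBlocks_mem_blocks {L M s : ℕ} {E : Finset (Sym2 Point)} (h : E ∈ tubePolygons L M)
    (hs : HasSpan E s) : (fun i : Fin (s + 1) => oneBlockAt E (i : ℕ)) ∈ blocks L M (s + 1) := by
  refine ⟨E, h, 0, fun i => ⟨?_, by simp⟩⟩
  obtain ⟨p, hp, hp0⟩ := h.2.2
  obtain ⟨q, hq, hqs⟩ := hs.1
  have := i.2
  exact h.1.isLoop.exists_mem_plane hp hq (by lia) (by dsimp at hqs; lia)

lemma oneBlocks_injOn (L M s : ℕ) : Set.InjOn
    (fun E => fun i : Fin (s + 1) => oneBlockAt E (i : ℕ))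
    {E | E ∈ tubePolygons L M ∧ HasSpan E s} := by
  have key : ∀ E ∈ {E | E ∈ tubePolygons L M ∧ HasSpan E s},
      ∀ F ∈ {E | E ∈ tubePolygons L M ∧ HasSpan E s},
      (fun i : Fin (s + 1) => oneBlockAt E (i : ℕ)) =
        (fun i : Fin (s + 1) => oneBlockAt F (i : ℕ)) → E ⊆ F := by
    rintro E ⟨hE, hsE⟩ F ⟨hF, _⟩ heq e he
    induction e with | _ p q
    have hp := left_mem_vertices he
    have h0 := (mem_tube.1 (hE.2.1 hp)).1
    have h1 : p.1 ≤ s := hsE.2 ⟨p, hp, rfl⟩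
    have h2 := congrFun heq ⟨p.1.toNat, by lia⟩
    simp only [Int.toNat_of_nonneg h0] at h2
    exact (mem_iff_of_oneBlockAt_eq hE.1.isLoop.lattice hF.1.isLoop.lattice h2 rfl).1 he
  exact fun E hE F hF heq => (key E hE F hF heq).antisymm (key F hF E hE heq.symm)

/-- The partition function of a finite set of polygons. -/
noncomputable def partitionSum {A : Set (Finset (Sym2 Point))} (hA : A.Finite) (z : ℝ) : ℝ :=
  ∑ E ∈ hA.toFinset, Real.exp (z * E.card)

lemma partitionSum_le {L M s : ℕ} {A : Set (Finset (Sym2 Point))} (hA : A.Finite)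
    (h : ∀ E ∈ A, E ∈ tubePolygons L M ∧ HasSpan E s) (z : ℝ) :
    partitionSum hA z ≤ Real.exp (z * (W L M * (s + 1 : ℕ))) * blockSum L M (s + 1) z := by
  rw [partitionSum, blockSum, Finset.mul_sum]
  refine sum_le_sum_of_injOn (fun E => fun i : Fin (s + 1) => oneBlockAt E (i : ℕ))
    (fun E hE => ?_) (fun E hE F hF => ?_) (fun E hE => ?_) fun b _ => ?_
  · have := h E (by simpa using hE)
    simpa using oneBlocks_mem_blocks this.1 this.2
  · exact oneBlocks_injOn L M s (h E (by simpa using hE)) (h F (by simpa using hF))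
  · have hE' := h E (by simpa using hE)
    have hc := card_eq_sum_length hE'.1 hE'.2
    rw [Finset.sum_range] at hc
    simp only [weight]
    rw [← Real.exp_sum, ← Finset.mul_sum, ← Real.exp_add, ← mul_add]
    apply le_of_eq
    congr 2
    have hc' : (E.card : ℝ) = ∑ i : Fin (s + 1), (((oneBlockAt E (i : ℕ)).length : ℚ) : ℝ) := by
      exact_mod_cast congrArg (Rat.cast : ℚ → ℝ) hc
    rw [Finset.sum_sub_distrib, ← hc', Finset.sum_const, Finset.card_univ, Fintype.card_fin,
      nsmul_eq_mul]
    ring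
  · exact mul_nonneg (Real.exp_pos _).le (Finset.prod_nonneg fun _ _ => (weight_pos L M z _).le)

lemma tsum_ncard_eq_partitionSum {A : Set (Finset (Sym2 Point))} (hA : A.Finite) (z : ℝ) :
    ∑' n : ℕ, ({E | E ∈ A ∧ E.card = n}.ncard : ℝ) * Real.exp (z * n) = partitionSum hA z := by
  classical
  have hcard : ∀ n, ({E | E ∈ A ∧ E.card = n}.ncard : ℝ) * Real.exp (z * n) =
      ∑ E ∈ hA.toFinset with E.card = n, Real.exp (z * E.card) := by
    intro n
    rw [Finset.sum_congr rfl (g := fun _ => Real.exp (z * n))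
      (fun E hE => by rw [(Finset.mem_filter.1 hE).2]), Finset.sum_const, nsmul_eq_mul,
      ← Set.ncard_coe_finset]
    congr 3
    ext E
    simp
  simp_rw [hcard]
  rw [tsum_eq_sum (s := hA.toFinset.image Finset.card), partitionSum]
  · exact Finset.sum_fiberwise_of_maps_to (fun E hE => Finset.mem_image_of_mem _ hE) _
  · intro n hn
    refine Finset.sum_eq_zero fun E hE => absurd ?_ hn
    rw [Finset.mem_filter] at hE
    exact Finset.mem_image.2 ⟨E, hE⟩

/-- The translation by `d` in the `x`-direction. -/
def shift (d : ℤ) : Point ≃ Point := (Equiv.addRight d).prodCongr (Equiv.refl _)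

/-- The translate of a set of edges by `d` in the `x`-direction. -/
def shiftEdges (d : ℤ) (E : Finset (Sym2 Point)) : Finset (Sym2 Point) := E.image (Sym2.map (shift d))

lemma mem_shiftEdges {d : ℤ} {E : Finset (Sym2 Point)} {p q : Point} :
    s(p, q) ∈ shiftEdges d E ↔ s((p.1 - d, p.2), (q.1 - d, q.2)) ∈ E := by
  rw [shiftEdges, mem_image_map, Sym2.map_mk]
  rfl

lemma mem_vertices_shiftEdges {d : ℤ} {E : Finset (Sym2 Point)} {p : Point} :
    p ∈ vertices (shiftEdges d E) ↔ (p.1 - d, p.2) ∈ vertices E := by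
  rw [shiftEdges, mem_vertices_image]
  rfl

lemma card_shiftEdges (d : ℤ) (E : Finset (Sym2 Point)) : (shiftEdges d E).card = E.card :=
  Finset.card_image_of_injective _ (Sym2.map.injective (shift d).injective)

lemma shiftEdges_injective (d : ℤ) : Function.Injective (shiftEdges d) :=
  Finset.image_injective (Sym2.map.injective (shift d).injective)

lemma IsPolygon.shiftEdges {E : Finset (Sym2 Point)} (h : IsPolygon E) (d : ℤ) :
    IsPolygon (shiftEdges d E) := by
  refine h.image _ fun p q hpq => ?_
  rw [adj_iff] at hpq ⊢
  simpa [shift] using hpq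

lemma oneBlockAt_shiftEdges (d k : ℤ) (E : Finset (Sym2 Point)) :
    oneBlockAt (shiftEdges d E) k = oneBlockAt E (k - d) := by
  refine oneBlockAt_congr fun p q _ => ?_
  rw [mem_shiftEdges]
  simp only [add_sub_assoc]

/-- The edge of the cross-section in the two extreme planes of the polygons of `𝒫*_𝕋`. -/
def cap : Sym2 (ℤ × ℤ) := s((0, 0), (1, 0))

/-- The edge `cap` in the plane `x = k`. -/
def capAt (k : ℤ) : Sym2 Point := s((k, 0, 0), (k, 1, 0))

lemma mem_hinge {E : Finset (Sym2 Point)} {k : ℤ} {u v : ℤ × ℤ} :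
    s(u, v) ∈ (oneBlockAt E k).hinge ↔ s(((k, u) : Point), (k, v)) ∈ E := Iff.rfl

lemma edgesInPlane_eq_image (E : Finset (Sym2 Point)) (k : ℤ) :
    edgesInPlane E k = Sym2.map (fun u => ((k, u) : Point)) '' (oneBlockAt E k).hinge := by
  ext e
  induction e with | _ p q
  simp only [edgesInPlane, Set.mem_ofPred_eq, Sym2.mem_iff, forall_eq_or_imp, forall_eq]
  constructor
  · obtain ⟨x, u⟩ := p
    obtain ⟨y, v⟩ := q
    rintro ⟨he, rfl, rfl⟩
    exact ⟨s(u, v), he, rfl⟩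
  · rintro ⟨e, he, heq⟩
    induction e with | _ u v
    rw [Sym2.map_mk] at heq
    rw [← heq]
    refine ⟨he, ?_⟩
    rcases Sym2.eq_iff.1 heq with ⟨rfl, rfl⟩ | ⟨rfl, rfl⟩ <;> exact ⟨rfl, rfl⟩

lemma map_injective (k : ℤ) : Function.Injective (Sym2.map fun u : ℤ × ℤ => ((k, u) : Point)) :=
  Sym2.map.injective fun _ _ h => (Prod.ext_iff.1 h).2

lemma edgesInPlane_eq_capAt_iff {E : Finset (Sym2 Point)} {k : ℤ} :
    edgesInPlane E k = {capAt k} ↔ (oneBlockAt E k).hinge = {cap} := by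
  rw [edgesInPlane_eq_image, show ({capAt k} : Set (Sym2 Point)) =
    Sym2.map (fun u => ((k, u) : Point)) '' {cap} by rw [Set.image_singleton]; rfl,
    (map_injective k).image_injective.eq_iff]

/-- The polygons with span from `x = a` to `x = b`, and ends as prescribed for the class `𝒫*_𝕋`
(in addition to this class, unit squares are allowed). -/
structure Capped (L M : ℕ) (a b : ℤ) (E : Finset (Sym2 Point)) : Prop where
  polygon : IsPolygon E
  mem : ∀ p ∈ vertices E, (a ≤ p.1 ∧ p.1 ≤ b) ∧ p.2 ∈ cross L M
  lt : a < b
  left : (oneBlockAt E a).hinge = {cap}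
  right : (oneBlockAt E b).hinge = {cap}
  penultimate : b = a + 1 ∨ (oneBlockAt E (b - 1)).hinge = ∅

lemma capAt_mem {E : Finset (Sym2 Point)} {k : ℤ} (h : (oneBlockAt E k).hinge = {cap}) :
    capAt k ∈ E := mem_hinge.1 (h ▸ Set.mem_singleton cap)

lemma Capped.mem_tubePolygons {L M s : ℕ} {E : Finset (Sym2 Point)} (h : Capped L M 0 s E) :
    E ∈ tubePolygons L M ∧ HasSpan E s := by
  have h0 := left_mem_vertices (capAt_mem h.left)
  have h1 := left_mem_vertices (capAt_mem h.right)
  refine ⟨⟨h.polygon, fun p hp => mem_tube.2 ⟨(h.mem p hp).1.1, (h.mem p hp).2⟩, _, h0, rfl⟩,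
    ⟨_, h1, rfl⟩, ?_⟩
  rintro _ ⟨p, hp, rfl⟩
  exact (h.mem p hp).1.2

lemma mem_starPolygons_iff {L M s : ℕ} (hs : 2 ≤ s) {E : Finset (Sym2 Point)} :
    E ∈ starPolygons L M s ↔ Capped L M 0 s E := by
  have hempty : edgesInPlane E ((s : ℤ) - 1) = ∅ ↔ (oneBlockAt E (s - 1)).hinge = ∅ := by
    rw [edgesInPlane_eq_image, Set.image_eq_empty]
  constructor
  · rintro ⟨h1, h2, _, h3, h4, h5⟩
    refine ⟨h1.1, fun p hp => ?_, by lia, edgesInPlane_eq_capAt_iff.1 h3,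
      edgesInPlane_eq_capAt_iff.1 h4, Or.inr (hempty.1 h5)⟩
    have := mem_tube.1 (h1.2.1 hp)
    exact ⟨⟨this.1, h2.2 ⟨p, hp, rfl⟩⟩, this.2⟩
  · intro h
    refine ⟨h.mem_tubePolygons.1, h.mem_tubePolygons.2, hs, edgesInPlane_eq_capAt_iff.2 h.left,
      edgesInPlane_eq_capAt_iff.2 h.right, hempty.2 (h.penultimate.resolve_left (by lia))⟩

lemma Capped.shiftEdges {L M : ℕ} {a b : ℤ} {E : Finset (Sym2 Point)} (h : Capped L M a b E)
    (d : ℤ) : Capped L M (a + d) (b + d) (shiftEdges d E) := by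
  refine ⟨h.polygon.shiftEdges d, fun p hp => ?_, by linarith [h.lt], ?_, ?_, ?_⟩
  · have := h.mem _ (mem_vertices_shiftEdges.1 hp)
    dsimp only at this
    exact ⟨by lia, this.2⟩
  · rw [oneBlockAt_shiftEdges, add_sub_cancel_right, h.left]
  · rw [oneBlockAt_shiftEdges, add_sub_cancel_right, h.right]
  · rw [oneBlockAt_shiftEdges, show b + d - 1 - d = b - 1 by ring]
    exact h.penultimate.imp (fun h => by lia) id

/-- A vertex without neighbour in the next plane has a neighbour in its own plane. -/
lemma IsLoop.exists_hinge {E : Finset (Sym2 Point)} (h : IsLoop E) {p : Point}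
    (hp : p ∈ vertices E) {σ : ℤ} (hσ : σ = 1 ∨ σ = -1) (hno : (p.1 + σ, p.2) ∉ vertices E) :
    ∃ v, s(p, (p.1, v)) ∈ E := by
  by_contra hcon
  push Not at hcon
  have hsub : {q | s(p, q) ∈ E} ⊆ {(p.1 - σ, p.2)} := by
    rintro ⟨y, v⟩ hq
    have hq : s(p, (y, v)) ∈ E := hq
    obtain ⟨x, u⟩ := p
    have hc := adj_cases (h.lattice hq)
    dsimp only at hc hno hcon ⊢
    rcases hc with rfl | ⟨rfl, hc⟩
    · exact absurd hq (hcon v)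
    · have : y ≠ x + σ := by
        rintro rfl
        exact hno (right_mem_vertices hq)
      simp only [Set.mem_singleton_iff, Prod.mk.injEq, and_true]
      lia
  have h1 := Set.ncard_le_ncard hsub
  rw [h.degree p hp, Set.ncard_singleton] at h1
  lia

lemma vertex_of_hinge_eq {E : Finset (Sym2 Point)} {p : Point} {v : ℤ × ℤ}
    (h : (oneBlockAt E p.1).hinge = {cap}) (hv : s(p, (p.1, v)) ∈ E) :
    p = (p.1, 0, 0) ∨ p = (p.1, 1, 0) := by
  obtain ⟨x, u⟩ := p
  have : s(u, v) ∈ (oneBlockAt E x).hinge := hv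
  rw [h, Set.mem_singleton_iff, cap, Sym2.eq_iff] at this
  rcases this with ⟨rfl, -⟩ | ⟨rfl, -⟩ <;> simp

lemma Capped.vertex_right {L M : ℕ} {a b : ℤ} {E : Finset (Sym2 Point)} (h : Capped L M a b E)
    {p : Point} (hp : p ∈ vertices E) (hb : p.1 = b) : p = (b, 0, 0) ∨ p = (b, 1, 0) := by
  subst hb
  obtain ⟨v, hv⟩ := h.polygon.isLoop.exists_hinge hp (Or.inl rfl) fun hmem => by
    have := (h.mem _ hmem).1.2
    dsimp only at this
    lia
  exact vertex_of_hinge_eq h.right hv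

/-- The concatenation of two polygons at the plane `x = b`. -/
def concat (b : ℤ) (E F : Finset (Sym2 Point)) : Finset (Sym2 Point) := (E ∪ F).erase (capAt b)

lemma mem_concat {b : ℤ} {E F : Finset (Sym2 Point)} {e : Sym2 Point} :
    e ∈ concat b E F ↔ e ≠ capAt b ∧ (e ∈ E ∨ e ∈ F) := by
  rw [concat, Finset.mem_erase, Finset.mem_union]

lemma eq_capAt_of_hinge_eq {E : Finset (Sym2 Point)} {b : ℤ} {p q : Point}
    (h : (oneBlockAt E b).hinge = {cap}) (he : s(p, q) ∈ E) (hp : p.1 = b) (hq : q.1 = b) :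
    s(p, q) = capAt b := by
  obtain ⟨x, u⟩ := p
  obtain ⟨y, v⟩ := q
  dsimp only at hp hq
  subst x y
  have : s(u, v) ∈ (oneBlockAt E b).hinge := he
  rw [h, Set.mem_singleton_iff] at this
  exact congrArg (Sym2.map fun u => ((b, u) : Point)) this

section concat
variable {L M : ℕ} {a b c : ℤ} {E F : Finset (Sym2 Point)}

lemma Capped.mem_left_iff (hE : Capped L M a b E) (hF : Capped L M b c F) (e : Sym2 Point) :
    e ∈ E ↔ e = capAt b ∨ (e ∈ concat b E F ∧ ∀ p ∈ e, p.1 ≤ b) := by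
  induction e with | _ p q
  rw [mem_concat]
  simp only [Sym2.mem_iff, forall_eq_or_imp, forall_eq]
  constructor
  · intro he
    have h1 := (hE.mem _ (left_mem_vertices he)).1.2
    have h2 := (hE.mem _ (right_mem_vertices he)).1.2
    tauto
  · rintro (h | ⟨⟨h1, h2 | h2⟩, h3, h4⟩)
    · exact h ▸ capAt_mem hE.right
    · exact h2
    · have h5 := (hF.mem _ (left_mem_vertices h2)).1.1
      have h6 := (hF.mem _ (right_mem_vertices h2)).1.1
      exact absurd (eq_capAt_of_hinge_eq hF.left h2 (by lia) (by lia)) h1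

lemma Capped.mem_right_iff (hE : Capped L M a b E) (hF : Capped L M b c F) (e : Sym2 Point) :
    e ∈ F ↔ e = capAt b ∨ (e ∈ concat b E F ∧ ∀ p ∈ e, b ≤ p.1) := by
  induction e with | _ p q
  rw [mem_concat]
  simp only [Sym2.mem_iff, forall_eq_or_imp, forall_eq]
  constructor
  · intro he
    have h1 := (hF.mem _ (left_mem_vertices he)).1.1
    have h2 := (hF.mem _ (right_mem_vertices he)).1.1
    tauto
  · rintro (h | ⟨⟨h1, h2 | h2⟩, h3, h4⟩)
    · exact h ▸ capAt_mem hF.left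
    · have h5 := (hE.mem _ (left_mem_vertices h2)).1.2
      have h6 := (hE.mem _ (right_mem_vertices h2)).1.2
      exact absurd (eq_capAt_of_hinge_eq hE.right h2 (by lia) (by lia)) h1
    · exact h2

lemma Capped.card_concat (hE : Capped L M a b E) (hF : Capped L M b c F) :
    (concat b E F).card + 2 = E.card + F.card := by
  have hinter : E ∩ F = {capAt b} := by
    ext e
    rw [Finset.mem_inter, Finset.mem_singleton]
    constructor
    · rintro ⟨h1, h2⟩
      by_contra hne
      induction e with | _ p q
      have h3 := hE.mem _ (left_mem_vertices h1)
      have h4 := hE.mem _ (right_mem_vertices h1)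
      have h5 := hF.mem _ (left_mem_vertices h2)
      have h6 := hF.mem _ (right_mem_vertices h2)
      exact hne (eq_capAt_of_hinge_eq hE.right h1 (by lia) (by lia))
    · rintro rfl
      exact ⟨capAt_mem hE.right, capAt_mem hF.left⟩
  have h1 := Finset.card_union_add_card_inter E F
  rw [hinter, Finset.card_singleton] at h1
  have h2 : capAt b ∈ E ∪ F := Finset.mem_union_left _ (capAt_mem hE.right)
  rw [concat, Finset.card_erase_of_mem h2]
  have := Finset.card_pos.2 ⟨_, h2⟩
  have := Finset.card_pos.2 ⟨_, capAt_mem hE.right⟩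
  have := Finset.card_pos.2 ⟨_, capAt_mem hF.left⟩
  lia

lemma Capped.concat (hE : Capped L M a b E) (hF : Capped L M b c F) :
    Capped L M a c (concat b E F) := by
  have hab := hE.lt
  have hbc := hF.lt
  have hne : ∀ {k : ℤ} {u v : ℤ × ℤ}, k ≠ b → s(((k, u) : Point), (k, v)) ≠ capAt b := by
    intro k u v hk heq
    rcases Sym2.eq_iff.1 heq with ⟨h1, _⟩ | ⟨h1, _⟩ <;> exact hk (Prod.ext_iff.1 h1).1
  have hleft : ∀ k, k < b → (oneBlockAt (TubePolygon.concat b E F) k).hinge =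
      (oneBlockAt E k).hinge := by
    intro k hk
    ext e
    induction e with | _ u v
    rw [mem_hinge, mem_hinge, mem_concat]
    refine ⟨fun h => h.2.resolve_right fun h' => ?_, fun h => ⟨hne hk.ne, Or.inl h⟩⟩
    have := (hF.mem _ (left_mem_vertices h')).1.1
    dsimp only at this
    lia
  have hright : ∀ k, b < k → (oneBlockAt (TubePolygon.concat b E F) k).hinge =
      (oneBlockAt F k).hinge := by
    intro k hk
    ext e
    induction e with | _ u v
    rw [mem_hinge, mem_hinge, mem_concat]
    refine ⟨fun h => h.2.resolve_left fun h' => ?_, fun h => ⟨hne hk.ne', Or.inr h⟩⟩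
    have := (hE.mem _ (left_mem_vertices h')).1.2
    dsimp only at this
    lia
  refine ⟨?_, ?_, by lia, by rw [hleft a hE.lt, hE.left], by rw [hright c hF.lt, hF.right],
    Or.inr ?_⟩
  · refine hE.polygon.merge hF.polygon (capAt_mem hE.right) (capAt_mem hF.left) fun p hpE hpF => ?_
    have h1 := hE.mem p hpE
    have h2 := hF.mem p hpF
    exact hE.vertex_right hpE (by lia)
  · intro p hp
    obtain ⟨q, hq⟩ := mem_vertices.1 hp
    rcases (mem_concat.1 hq).2 with h | h
    · have := hE.mem p (left_mem_vertices h)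
      exact ⟨by lia, this.2⟩
    · have := hF.mem p (left_mem_vertices h)
      exact ⟨by lia, this.2⟩
  · rcases hF.penultimate with rfl | h
    · rw [add_sub_cancel_right, Set.eq_empty_iff_forall_notMem]
      intro e he
      induction e with | _ u v
      rw [mem_hinge, mem_concat] at he
      rcases he.2 with h | h
      · exact he.1 (eq_capAt_of_hinge_eq hE.right h rfl rfl)
      · exact he.1 (eq_capAt_of_hinge_eq hF.left h rfl rfl)
    · by_cases hc : c = b + 1
      · subst hc
        rw [add_sub_cancel_right, hF.left] at h
        exact absurd h (Set.singleton_ne_empty _)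
      · rw [hright _ (by lia), h]

end concat

lemma capped_square {L M : ℕ} (hL : 0 < L) :
    Capped L M 0 1 (square (0, 0, 0) (0, 1, 0) (1, 1, 0) (1, 0, 0)) := by
  have hhinge : ∀ k : ℤ, k = 0 ∨ k = 1 →
      (oneBlockAt (square (0, 0, 0) (0, 1, 0) (1, 1, 0) (1, 0, 0)) k).hinge = {cap} := by
    intro k hk
    ext e
    induction e with | _ u v
    rw [mem_hinge, Set.mem_singleton_iff, cap, square]
    rcases hk with rfl | rfl <;> (simp; try tauto)
  refine ⟨isPolygon_square ?_ ?_ ?_ ?_ ?_ ?_, ?_, zero_lt_one, hhinge 0 (Or.inl rfl),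
    hhinge 1 (Or.inr rfl), Or.inl rfl⟩
  any_goals simp [adj_iff]
  intro p q r hp
  rw [vertices_square] at hp
  rw [mem_cross]
  simp only [Prod.mk.injEq] at hp
  lia

lemma capped_finite (L M s : ℕ) : {E | Capped L M 0 s E}.Finite :=
  (tubePolygons_finite L M s).subset fun _ h => h.mem_tubePolygons

/-- The partition function of the polygons `Capped L M 0 s`. -/
noncomputable def cappedSum (L M s : ℕ) (z : ℝ) : ℝ := partitionSum (capped_finite L M s) z

lemma QStar_eq {L M s : ℕ} (hs : 2 ≤ s) (z : ℝ) : QStar L M s z = cappedSum L M s z := by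
  have hset : starPolygons L M s = {E | Capped L M 0 s E} := by
    ext E
    exact mem_starPolygons_iff hs
  rw [cappedSum, ← tsum_ncard_eq_partitionSum]
  simp only [QStar, qStar, hset]

/-- Concatenation makes the partition functions supermultiplicative. -/
lemma cappedSum_mul_le (L M m n : ℕ) (z : ℝ) :
    Real.exp (-(2 * z)) * (cappedSum L M m z * cappedSum L M n z) ≤ cappedSum L M (m + n) z := by
  rw [cappedSum, cappedSum, cappedSum, partitionSum, partitionSum, partitionSum,
    Finset.sum_mul_sum, ← Finset.sum_product', Finset.mul_sum]
  have hcap : ∀ x ∈ (capped_finite L M m).toFinset ×ˢ (capped_finite L M n).toFinset,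
      Capped L M 0 m x.1 ∧ Capped L M m (m + n : ℕ) (shiftEdges m x.2) := by
    rintro ⟨E, F⟩ hx
    simp only [Finset.mem_product, Set.Finite.mem_toFinset, Set.mem_ofPred_eq] at hx
    refine ⟨hx.1, ?_⟩
    have := hx.2.shiftEdges m
    rwa [zero_add, show (n : ℤ) + m = (m + n : ℕ) by push_cast; ring] at this
  refine sum_le_sum_of_injOn (fun x => concat m x.1 (shiftEdges m x.2)) (fun x hx => ?_)
    (fun x hx y hy hxy => ?_) (fun x hx => ?_) fun _ _ => (Real.exp_pos _).le
  · obtain ⟨h1, h2⟩ := hcap x hx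
    simpa using h1.concat h2
  · obtain ⟨h1, h2⟩ := hcap x hx
    obtain ⟨h3, h4⟩ := hcap y hy
    dsimp only at hxy
    refine Prod.ext ?_ (shiftEdges_injective m ?_) <;> ext e
    · rw [h1.mem_left_iff h2, h3.mem_left_iff h4, hxy]
    · rw [h1.mem_right_iff h2, h3.mem_right_iff h4, hxy]
  · obtain ⟨h1, h2⟩ := hcap x hx
    have h3 := h1.card_concat h2
    rw [card_shiftEdges] at h3
    have h4 : ((concat m x.1 (shiftEdges m x.2)).card : ℝ) + 2 = x.1.card + x.2.card := by
      exact_mod_cast h3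
    rw [← Real.exp_add, ← Real.exp_add]
    apply le_of_eq
    congr 1
    linear_combination (-z) * h4

lemma cappedSum_pos {L M s : ℕ} (hL : 0 < L) (hs : 1 ≤ s) (z : ℝ) : 0 < cappedSum L M s z := by
  have h1 : 0 < cappedSum L M 1 z :=
    Finset.sum_pos (fun _ _ => Real.exp_pos _)
      ⟨_, (Set.Finite.mem_toFinset _).2 (by exact_mod_cast capped_square (M := M) hL)⟩
  induction s, hs using Nat.le_induction with
  | base => exact h1
  | succ s _ ih =>
    exact (mul_pos (Real.exp_pos _) (mul_pos ih h1)).trans_le (cappedSum_mul_le L M s 1 z)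

lemma cappedSum_le (L M s : ℕ) (z : ℝ) :
    cappedSum L M s z ≤ Real.exp (z * (W L M * (s + 1 : ℕ))) * blockSum L M (s + 1) z :=
  partitionSum_le _ (fun _ h => Capped.mem_tubePolygons h) z

lemma blockSum_pos {L M : ℕ} (hL : 0 < L) (s : ℕ) (z : ℝ) : 0 < blockSum L M (s + 2) z := by
  have h1 := (cappedSum_pos (M := M) (s := s + 1) hL (by lia) z).trans_le (cappedSum_le L M _ z)
  exact pos_of_mul_pos_right h1 (Real.exp_pos _).le

lemma blockSum_one_pos {L M : ℕ} (hL : 0 < L) (z : ℝ) : 0 < blockSum L M 1 z := by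
  have h2 : 0 < blockSum L M 1 z * blockSum L M 1 z :=
    (blockSum_pos hL 0 z).trans_le (blockSum_add_le L M 1 1 z)
  exact (blockSum_nonneg L M 1 z).lt_of_ne fun h => by simp [← h] at h2

/-- The dual free energy exists, as a limit from below after a normalization. -/
theorem tendsto_dualFreeEnergy {L : ℕ} (M : ℕ) (hL : 0 < L) (z : ℝ) :
    Tendsto (fun s : ℕ => (1 / (s : ℝ)) * Real.log (QStar L M s z))
      atTop (𝓝 (dualFreeEnergy L M z)) ∧
    ∀ s : ℕ, 1 ≤ s → Real.log (cappedSum L M s z) ≤ 2 * z + s * dualFreeEnergy L M z := by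
  set u : ℕ → ℝ := fun n => if n = 0 then 0 else 2 * z - Real.log (cappedSum L M n z) with hu
  have hu' : ∀ n, 1 ≤ n → u n = 2 * z - Real.log (cappedSum L M n z) := fun n hn => by
    rw [hu]
    dsimp only
    rw [if_neg (by lia)]
  have hsub : Subadditive u := by
    intro m n
    rcases Nat.eq_zero_or_pos m with rfl | hm
    · simp [hu]
    rcases Nat.eq_zero_or_pos n with rfl | hn
    · simp [hu]
    rw [hu' _ hm, hu' _ hn, hu' _ (by lia)]
    have hm' := cappedSum_pos (M := M) hL hm z
    have hn' := cappedSum_pos (M := M) hL hn z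
    have := Real.log_le_log (mul_pos (Real.exp_pos _) (mul_pos hm' hn'))
      (cappedSum_mul_le L M m n z)
    rw [Real.log_mul (Real.exp_pos _).ne' (mul_pos hm' hn').ne', Real.log_exp,
      Real.log_mul hm'.ne' hn'.ne'] at this
    linarith
  set K := z * W L M + Real.log (blockSum L M 1 z) with hK
  have hB := blockSum_one_pos (M := M) hL z
  have hlog : ∀ n, 1 ≤ n → Real.log (cappedSum L M n z) ≤ (n + 1) * K := by
    intro n hn
    have h1 := blockSum_mul_le L M 1 n z
    rw [mul_one] at h1
    have h2 := (cappedSum_le L M n z).trans (mul_le_mul_of_nonneg_left h1 (Real.exp_pos _).le)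
    have h3 := Real.log_le_log (cappedSum_pos hL hn z) h2
    rw [Real.log_mul (Real.exp_pos _).ne' (pow_pos hB _).ne', Real.log_exp, Real.log_pow] at h3
    push_cast at h3
    rw [hK]
    linarith
  have hbdd : BddBelow (Set.range fun n => u n / n) := by
    refine ⟨-(2 * |z|) - 2 * |K|, ?_⟩
    rintro _ ⟨n, rfl⟩
    dsimp only
    rcases Nat.eq_zero_or_pos n with rfl | hn
    · simp only [Nat.cast_zero, div_zero]
      linarith [abs_nonneg z, abs_nonneg K]
    · have hn1 : (1 : ℝ) ≤ n := by exact_mod_cast hn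
      rw [hu' n hn, le_div_iff₀ (by linarith)]
      have h1 := hlog n hn
      have h2 : ((n : ℝ) + 1) * K ≤ (2 * n) * |K| := by
        calc ((n : ℝ) + 1) * K ≤ (n + 1) * |K| :=
              mul_le_mul_of_nonneg_left (le_abs_self K) (by linarith)
          _ ≤ (2 * n) * |K| := mul_le_mul_of_nonneg_right (by linarith) (abs_nonneg K)
      have h3 : |z| ≤ n * |z| := le_mul_of_one_le_left (abs_nonneg z) hn1
      have h4 := neg_abs_le z
      linarith
  have hlim := hsub.tendsto_lim hbdd
  have h2 : Tendsto (fun s : ℕ => (1 / (s : ℝ)) * Real.log (QStar L M s z)) atTop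
      (𝓝 (-hsub.lim)) := by
    have h3 : Tendsto (fun n : ℕ => 2 * z / n - u n / n) atTop (𝓝 (0 - hsub.lim)) :=
      (tendsto_const_div_atTop_nhds_zero_nat _).sub hlim
    rw [zero_sub] at h3
    refine h3.congr' ?_
    filter_upwards [eventually_ge_atTop 2] with n hn
    rw [hu' n (by lia), QStar_eq hn]
    ring
  have hG : dualFreeEnergy L M z = -hsub.lim := h2.limUnder_eq
  refine ⟨hG ▸ h2, fun s hs => ?_⟩
  have h4 := hsub.lim_le_div hbdd (n := s) (by lia)
  rw [hu' s hs, le_div_iff₀ (by exact_mod_cast hs)] at h4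
  rw [hG]
  linarith

/-- The result of attaching the unit square with corners `a, b, c, d` along its side `a, b`. -/
def attach (E : Finset (Sym2 Point)) (a b c d : Point) : Finset (Sym2 Point) :=
  (E ∪ square a b c d).erase s(a, b)

section attach
variable {E : Finset (Sym2 Point)} {a b c d : Point}

lemma mem_attach {e : Sym2 Point} : e ∈ attach E a b c d ↔
    e ≠ s(a, b) ∧ (e ∈ E ∨ e = s(b, c) ∨ e = s(c, d) ∨ e = s(d, a)) := by
  simp only [attach, square, Finset.mem_erase, Finset.mem_union, Finset.mem_insert,
    Finset.mem_singleton]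
  tauto

lemma isPolygon_attach (hE : IsPolygon E) (hab : s(a, b) ∈ E) (hbc : cubicLattice.Adj b c)
    (hcd : cubicLattice.Adj c d) (hda : cubicLattice.Adj d a) (hc : c ∉ vertices E)
    (hd : d ∉ vertices E) : IsPolygon (attach E a b c d) := by
  refine hE.merge (isPolygon_square (hE.isLoop.lattice hab) hbc hcd hda ?_ ?_) hab
    (by simp [square]) fun p hp hp' => ?_
  · rintro rfl
    exact hc (left_mem_vertices hab)
  · rintro rfl
    exact hd (right_mem_vertices hab)
  · rcases vertices_square.1 hp' with rfl | rfl | rfl | rfl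
    exacts [Or.inl rfl, Or.inr rfl, absurd hp hc, absurd hp hd]

lemma vertices_attach (hab : s(a, b) ∈ E) (hc : c ∉ vertices E) (hd : d ∉ vertices E)
    {p : Point} : p ∈ vertices (attach E a b c d) ↔ p ∈ vertices E ∨ p = c ∨ p = d := by
  have hca : c ≠ a := fun h => hc (h ▸ left_mem_vertices hab)
  have hda : d ≠ a := fun h => hd (h ▸ left_mem_vertices hab)
  have hcb : c ≠ b := fun h => hc (h ▸ right_mem_vertices hab)
  have hdb : d ≠ b := fun h => hd (h ▸ right_mem_vertices hab)
  have h1 : s(b, c) ∈ attach E a b c d := by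
    rw [mem_attach, ne_eq, Sym2.eq_iff]
    tauto
  have h2 : s(d, a) ∈ attach E a b c d := by
    rw [mem_attach, ne_eq, Sym2.eq_iff]
    tauto
  constructor
  · intro hp
    obtain ⟨q, hq⟩ := mem_vertices.1 hp
    rcases (mem_attach.1 hq).2 with h | h | h | h
    · exact Or.inl (left_mem_vertices h)
    · rcases Sym2.eq_iff.1 h with ⟨rfl, -⟩ | ⟨rfl, -⟩
      · exact Or.inl (right_mem_vertices hab)
      · tauto
    · rcases Sym2.eq_iff.1 h with ⟨rfl, -⟩ | ⟨rfl, -⟩ <;> tauto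
    · rcases Sym2.eq_iff.1 h with ⟨rfl, -⟩ | ⟨rfl, -⟩
      · tauto
      · exact Or.inl (left_mem_vertices hab)
  · rintro (hp | rfl | rfl)
    · by_cases hpa : p = a
      · exact hpa.symm ▸ right_mem_vertices h2
      by_cases hpb : p = b
      · exact hpb.symm ▸ left_mem_vertices h1
      obtain ⟨q, hq⟩ := mem_vertices.1 hp
      refine left_mem_vertices (mem_attach.2 ⟨?_, Or.inl hq⟩)
      rw [ne_eq, Sym2.eq_iff]
      tauto
    · exact right_mem_vertices h1
    · exact left_mem_vertices h2

end attach

/-- A polygon in the cross-section `[0, L] × [0, M]` which ends on the right, in the plane `x = b`,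
with the single edge `u, v`. -/
structure RightEnd (L M : ℕ) (E : Finset (Sym2 Point)) (b : ℤ) (u v : ℤ × ℤ) : Prop where
  polygon : IsPolygon E
  mem : ∀ p ∈ vertices E, p.1 ≤ b ∧ p.2 ∈ cross L M
  edge : s(((b, u) : Point), (b, v)) ∈ E
  only : ∀ w, ((b, w) : Point) ∈ vertices E → w = u ∨ w = v

/-- The sets `E` and `F` have the same edges to the left of the plane `x = b`. -/
def AgreeLeft (b : ℤ) (E F : Finset (Sym2 Point)) : Prop :=
  ∀ p q : Point, p.1 < b → (s(p, q) ∈ F ↔ s(p, q) ∈ E)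

lemma AgreeLeft.trans {b b' : ℤ} {E F G : Finset (Sym2 Point)} (h : AgreeLeft b E F)
    (h' : AgreeLeft b' F G) (hb : b ≤ b') : AgreeLeft b E G :=
  fun p q hp => (h' p q (by lia)).trans (h p q hp)

lemma agreeLeft_attach {E : Finset (Sym2 Point)} {b : ℤ} {p q r t : Point} (hp : b ≤ p.1)
    (hq : b ≤ q.1) (hr : b ≤ r.1) (ht : b ≤ t.1) : AgreeLeft b E (attach E p q r t) := by
  intro x y hx
  have key : ∀ {p q : Point}, b ≤ p.1 → b ≤ q.1 → s(x, y) ≠ s(p, q) := by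
    intro p q hp hq h
    rcases Sym2.eq_iff.1 h with ⟨rfl, -⟩ | ⟨rfl, -⟩ <;> lia
  rw [mem_attach]
  have h1 := key hp hq
  have h2 := key hq hr
  have h3 := key hr ht
  have h4 := key ht hp
  tauto

section RightEnd
variable {L M : ℕ} {E : Finset (Sym2 Point)} {b : ℤ} {u v w : ℤ × ℤ}

lemma RightEnd.swap (h : RightEnd L M E b u v) : RightEnd L M E b v u :=
  ⟨h.polygon, h.mem, Sym2.eq_swap ▸ h.edge, fun w hw => (h.only w hw).symm⟩

lemma adj_succ (b : ℤ) (u : ℤ × ℤ) : cubicLattice.Adj (b, u) (b + 1, u) := by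
  rw [adj_iff]
  simp

lemma adj_translate {b : ℤ} (c : ℤ) (h : cubicLattice.Adj (b, u) (b, v)) :
    cubicLattice.Adj (c, u) (c, v) := by
  rw [adj_iff] at h ⊢
  simpa using h

/-- The polygon prolonged to the right by one unit square on the edge `u, v` of `x = b`. -/
def prolong (E : Finset (Sym2 Point)) (b : ℤ) (u v : ℤ × ℤ) : Finset (Sym2 Point) :=
  attach E (b, u) (b, v) (b + 1, v) (b + 1, u)

lemma notMem_of_lt (hE : ∀ p ∈ vertices E, p.1 ≤ b ∧ p.2 ∈ cross L M) {c : ℤ} (hc : b < c)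
    (u : ℤ × ℤ) : ((c, u) : Point) ∉ vertices E := fun h => by
  have := (hE _ h).1
  dsimp only at this
  lia

lemma vertices_prolong (hE : ∀ p ∈ vertices E, p.1 ≤ b ∧ p.2 ∈ cross L M)
    (hedge : s(((b, u) : Point), (b, v)) ∈ E) {p : Point} : p ∈ vertices (prolong E b u v) ↔
      p ∈ vertices E ∨ p = (b + 1, v) ∨ p = (b + 1, u) :=
  vertices_attach hedge (notMem_of_lt hE (by lia) v) (notMem_of_lt hE (by lia) u)

lemma rightEnd_prolong (h : IsPolygon E) (hE : ∀ p ∈ vertices E, p.1 ≤ b ∧ p.2 ∈ cross L M)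
    (hedge : s(((b, u) : Point), (b, v)) ∈ E) : RightEnd L M (prolong E b u v) (b + 1) u v := by
  have hu := (hE _ (left_mem_vertices hedge)).2
  have hv := (hE _ (right_mem_vertices hedge)).2
  refine ⟨isPolygon_attach h hedge (adj_succ b v)
    (adj_translate _ (h.isLoop.lattice hedge)).symm (adj_succ b u).symm
    (notMem_of_lt hE (by lia) v) (notMem_of_lt hE (by lia) u), ?_, ?_, ?_⟩
  · intro p hp
    rcases (vertices_prolong hE hedge).1 hp with hp | rfl | rfl
    · exact ⟨by have := (hE p hp).1; lia, (hE p hp).2⟩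
    · exact ⟨le_rfl, hv⟩
    · exact ⟨le_rfl, hu⟩
  · rw [prolong, mem_attach]
    refine ⟨?_, Or.inr (Or.inr (Or.inl Sym2.eq_swap))⟩
    rw [ne_eq, Sym2.eq_iff]
    simp
  · intro w hw
    rcases (vertices_prolong hE hedge).1 hw with hp | hp | hp
    · exact absurd hp (notMem_of_lt hE (by lia) w)
    · exact Or.inr (Prod.ext_iff.1 hp).2
    · exact Or.inl (Prod.ext_iff.1 hp).2

lemma agreeLeft_prolong : AgreeLeft b E (prolong E b u v) :=
  agreeLeft_attach le_rfl le_rfl (by simp) (by simp)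

lemma RightEnd.hinge (h : RightEnd L M E b u v) : (oneBlockAt E b).hinge = {s(u, v)} := by
  ext e
  induction e with | _ x y
  rw [mem_hinge, Set.mem_singleton_iff]
  constructor
  · intro he
    have hne : x ≠ y := fun hxy => (h.polygon.isLoop.lattice he).ne (by rw [hxy])
    have h1 := h.only x (left_mem_vertices he)
    have h2 := h.only y (right_mem_vertices he)
    rw [Sym2.eq_iff]
    grind
  · intro he
    have := congrArg (Sym2.map fun u => ((b, u) : Point)) he
    simp only [Sym2.map_mk] at this
    exact this ▸ h.edge

lemma RightEnd.hinge_prolong (h : RightEnd L M E b u v) :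
    (oneBlockAt (prolong E b u v) b).hinge = ∅ := by
  rw [Set.eq_empty_iff_forall_notMem]
  intro e he
  induction e with | _ x y
  rw [mem_hinge, prolong, mem_attach] at he
  obtain ⟨h1, h2 | h2 | h2 | h2⟩ := he
  · have : s(x, y) ∈ (oneBlockAt E b).hinge := h2
    rw [h.hinge, Set.mem_singleton_iff] at this
    exact h1 (congrArg (Sym2.map fun u => ((b, u) : Point)) this)
  all_goals
    rw [Sym2.eq_iff] at h2
    simp at h2

/-- Turning the end of a polygon from the edge `u, v` to an adjacent edge `v, w`. -/
lemma RightEnd.turn (h : RightEnd L M E b u v) (hw : w ∈ cross L M)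
    (hvw : cubicLattice.Adj (b, v) (b, w)) (hwu : w ≠ u) :
    ∃ F, RightEnd L M F (b + 2) v w ∧ AgreeLeft b E F := by
  have hvw' : v ≠ w := fun h => hvw.ne (by rw [h])
  have huv : u ≠ v := fun huv => (h.polygon.isLoop.lattice h.edge).ne (by rw [huv])
  set F := prolong E b u v with hF
  have hFend := rightEnd_prolong h.polygon h.mem h.edge
  have hFv := fun {p} => vertices_prolong h.mem h.edge (p := p)
  rw [← hF] at hFend hFv
  have hside : s(((b, v) : Point), (b + 1, v)) ∈ F := by
    rw [hF, prolong, mem_attach]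
    refine ⟨?_, Or.inr (Or.inl rfl)⟩
    rw [ne_eq, Sym2.eq_iff]
    simp
  have hw0 : ((b, w) : Point) ∉ vertices F := by
    rw [hFv]
    rintro (hm | hm | hm)
    · rcases h.only w hm with rfl | rfl <;> contradiction
    all_goals simp at hm
  have hw1 : ((b + 1, w) : Point) ∉ vertices F := by
    intro hm
    rcases hFend.only w hm with rfl | rfl <;> contradiction
  set G := attach F (b + 1, v) (b, v) (b, w) (b + 1, w) with hG
  have hside' : s(((b + 1, v) : Point), (b, v)) ∈ F := Sym2.eq_swap ▸ hside
  have hGp : IsPolygon G := isPolygon_attach hFend.polygon hside' hvw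
    (adj_succ b w) (adj_translate _ hvw).symm hw0 hw1
  have hGv := fun {p} => vertices_attach (p := p) hside' hw0 hw1
  rw [← hG] at hGv
  have hGm : ∀ p ∈ vertices G, p.1 ≤ b + 1 ∧ p.2 ∈ cross L M := by
    intro p hp
    rcases hGv.1 hp with hp | rfl | rfl
    · exact hFend.mem p hp
    · exact ⟨by simp, hw⟩
    · exact ⟨le_rfl, hw⟩
  have hGe : s(((b + 1, v) : Point), (b + 1, w)) ∈ G := by
    rw [hG, mem_attach]
    refine ⟨?_, Or.inr (Or.inr (Or.inr Sym2.eq_swap))⟩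
    rw [ne_eq, Sym2.eq_iff]
    simp
  have hend := rightEnd_prolong hGp hGm hGe
  rw [show b + 1 + 1 = b + 2 by ring] at hend
  refine ⟨_, hend, ?_⟩
  have h1 : AgreeLeft b E F := agreeLeft_prolong
  have h2 : AgreeLeft b F G := agreeLeft_attach (by simp) (by simp) (by simp) (by simp)
  exact (h1.trans h2 le_rfl).trans agreeLeft_prolong (by lia)

/-- The end of a polygon can be turned to the edge `cap`. -/
lemma RightEnd.exists_cap (hL : 0 < L) (h : RightEnd L M E b u v) :
    ∃ F c, b ≤ c ∧ RightEnd L M F c (0, 0) (1, 0) ∧ AgreeLeft b E F := by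
  induction hn : (v.1 + v.2).toNat using Nat.strong_induction_on generalizing E b u v with
  | _ n ih =>
    have hu := mem_cross.1 (h.mem _ (left_mem_vertices h.edge)).2
    have hv := mem_cross.1 (h.mem _ (right_mem_vertices h.edge)).2
    have step : ∀ w : ℤ × ℤ, w ∈ cross L M → cubicLattice.Adj (b, v) (b, w) →
        (w.1 + w.2).toNat < (v.1 + v.2).toNat →
        ∃ F c, b ≤ c ∧ RightEnd L M F c (0, 0) (1, 0) ∧ AgreeLeft b E F := by
      intro w hw hvw hlt
      by_cases hwu : w = u
      · subst hwu
        exact ih _ (hn ▸ hlt) h.swap rfl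
      · obtain ⟨F, hF, hEF⟩ := h.turn hw hvw hwu
        obtain ⟨G, c, hc, hG, hFG⟩ := ih _ (hn ▸ hlt) hF rfl
        exact ⟨G, c, by lia, hG, hEF.trans hFG (by lia)⟩
    obtain ⟨y, z⟩ := v
    dsimp only at hv step hn
    by_cases hy : 0 < y
    · refine step (y - 1, z) ?_ ?_ ?_
      · rw [mem_cross]
        dsimp only
        lia
      · rw [adj_iff]
        simp
      · dsimp only
        lia
    by_cases hz : 0 < z
    · refine step (y, z - 1) ?_ ?_ ?_
      · rw [mem_cross]
        dsimp only
        lia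
      · rw [adj_iff]
        simp
      · dsimp only
        lia
    obtain rfl : y = 0 := by lia
    obtain rfl : z = 0 := by lia
    by_cases hu1 : u = (1, 0)
    · subst hu1
      exact ⟨E, b, le_rfl, h.swap, fun _ _ _ => Iff.rfl⟩
    · obtain ⟨F, hF, hEF⟩ := h.turn (w := (1, 0)) (by rw [mem_cross]; dsimp only; lia)
        (by rw [adj_iff]; simp) (Ne.symm hu1)
      exact ⟨F, b + 2, by lia, hF, hEF⟩

end RightEnd

/-- Every polygon can be modified at its right end, and prolonged, so that it ends with `cap`. -/
lemma exists_right_cap {L M : ℕ} (hL : 0 < L) {E : Finset (Sym2 Point)} (h : IsPolygon E) {b : ℤ}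
    (hE : ∀ p ∈ vertices E, p.1 ≤ b ∧ p.2 ∈ cross L M) (hb : ∃ p ∈ vertices E, p.1 = b) :
    ∃ F c, b + 2 ≤ c ∧ IsPolygon F ∧ (∀ p ∈ vertices F, p.1 ≤ c ∧ p.2 ∈ cross L M) ∧
      (oneBlockAt F c).hinge = {cap} ∧ (oneBlockAt F (c - 1)).hinge = ∅ ∧ AgreeLeft b E F := by
  obtain ⟨⟨x, u⟩, hp, rfl⟩ := hb
  obtain ⟨v, hv⟩ := h.isLoop.exists_hinge hp (Or.inl rfl) (notMem_of_lt hE (by simp) u)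
  have h1 := rightEnd_prolong h hE hv
  obtain ⟨F, c, hc, hF, hEF⟩ := h1.exists_cap hL
  have h2 := rightEnd_prolong hF.polygon hF.mem hF.edge
  dsimp only at hc hEF ⊢
  refine ⟨_, c + 1, by lia, h2.polygon, h2.mem, h2.hinge, ?_, ?_⟩
  · rw [add_sub_cancel_right]
    exact hF.hinge_prolong
  · exact (agreeLeft_prolong.trans hEF (by lia)).trans agreeLeft_prolong (by lia)

/-- The reflection `x ↦ -x`. -/
def reflection : Point ≃ Point := (Equiv.neg ℤ).prodCongr (Equiv.refl _)

/-- The mirror image of a set of edges. -/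
def reflectEdges (E : Finset (Sym2 Point)) : Finset (Sym2 Point) := E.image (Sym2.map reflection)

lemma mem_reflectEdges {E : Finset (Sym2 Point)} {p q : Point} :
    s(p, q) ∈ reflectEdges E ↔ s((-p.1, p.2), (-q.1, q.2)) ∈ E := by
  rw [reflectEdges, mem_image_map, Sym2.map_mk]
  rfl

lemma mem_vertices_reflectEdges {E : Finset (Sym2 Point)} {p : Point} :
    p ∈ vertices (reflectEdges E) ↔ (-p.1, p.2) ∈ vertices E := by
  rw [reflectEdges, mem_vertices_image]
  rfl

lemma IsPolygon.reflectEdges {E : Finset (Sym2 Point)} (h : IsPolygon E) :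
    IsPolygon (reflectEdges E) := by
  refine h.image _ fun p q hpq => ?_
  rw [adj_iff] at hpq ⊢
  rw [abs_sub_comm p.1] at hpq
  simp only [reflection, Equiv.prodCongr_apply, Prod.map_fst, Prod.map_snd, Equiv.neg_apply,
    Equiv.refl_apply]
  rwa [show -p.1 - -q.1 = q.1 - p.1 by ring]

lemma hinge_reflectEdges (E : Finset (Sym2 Point)) (k : ℤ) :
    (oneBlockAt (reflectEdges E) k).hinge = (oneBlockAt E (-k)).hinge := by
  ext e
  induction e with | _ u v
  rw [mem_hinge, mem_hinge, mem_reflectEdges]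

lemma exists_left_cap {L M : ℕ} (hL : 0 < L) {E : Finset (Sym2 Point)} (h : IsPolygon E) {a : ℤ}
    (hE : ∀ p ∈ vertices E, a ≤ p.1 ∧ p.2 ∈ cross L M) (ha : ∃ p ∈ vertices E, p.1 = a) :
    ∃ F c, c + 2 ≤ a ∧ IsPolygon F ∧ (∀ p ∈ vertices F, c ≤ p.1 ∧ p.2 ∈ cross L M) ∧
      (oneBlockAt F c).hinge = {cap} ∧
      ∀ p q : Point, a < p.1 → (s(p, q) ∈ F ↔ s(p, q) ∈ E) := by
  obtain ⟨F, c, hc, hF, hFm, hFc, -, hEF⟩ := exists_right_cap hL h.reflectEdges (b := -a)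
    (fun p hp => by
      have := hE _ (mem_vertices_reflectEdges.1 hp)
      dsimp only at this
      exact ⟨by lia, this.2⟩) (by
      obtain ⟨p, hp, rfl⟩ := ha
      exact ⟨(-p.1, p.2), mem_vertices_reflectEdges.2 (by simpa using hp), rfl⟩)
  refine ⟨reflectEdges F, -c, by lia, hF.reflectEdges, fun p hp => ?_, ?_, fun p q hp => ?_⟩
  · have := hFm _ (mem_vertices_reflectEdges.1 hp)
    dsimp only at this
    exact ⟨by lia, this.2⟩
  · rw [hinge_reflectEdges, neg_neg, hFc]
  · rw [mem_reflectEdges, hEF _ _ (by dsimp only; lia), mem_reflectEdges]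
    simp

/-- The interior of any polygon occurs in a polygon with prescribed ends. -/
theorem exists_capped {L M : ℕ} (hL : 0 < L) {E : Finset (Sym2 Point)} (h : IsPolygon E) {a b : ℤ}
    (hab : a < b) (hE : ∀ p ∈ vertices E, (a ≤ p.1 ∧ p.1 ≤ b) ∧ p.2 ∈ cross L M)
    (ha : ∃ p ∈ vertices E, p.1 = a) (hb : ∃ p ∈ vertices E, p.1 = b) :
    ∃ F c d, c + 2 ≤ a ∧ b + 2 ≤ d ∧ Capped L M c d F ∧
      ∀ k, a < k → k < b → oneBlockAt F k = oneBlockAt E k := by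
  obtain ⟨F, d, hd, hF, hFm, hFd, hFd', hEF⟩ := exists_right_cap hL h
    (fun p hp => ⟨(hE p hp).1.2, (hE p hp).2⟩) hb
  have hFa : ∀ p ∈ vertices F, a ≤ p.1 ∧ p.2 ∈ cross L M := by
    intro p hp
    refine ⟨?_, (hFm p hp).2⟩
    by_contra hlt
    obtain ⟨q, hq⟩ := mem_vertices.1 hp
    have := (hE p (left_mem_vertices ((hEF p q (by lia)).1 hq))).1
    lia
  obtain ⟨G, c, hc, hG, hGm, hGc, hFG⟩ := exists_left_cap hL hF hFa (by
    obtain ⟨p, hp, rfl⟩ := ha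
    obtain ⟨q, hq⟩ := mem_vertices.1 hp
    exact ⟨p, left_mem_vertices ((hEF p q hab).2 hq), rfl⟩)
  have hhinge : ∀ k, a < k → (oneBlockAt G k).hinge = (oneBlockAt F k).hinge := by
    intro k hk
    ext e
    induction e with | _ u v
    rw [mem_hinge, mem_hinge, hFG _ _ hk]
  refine ⟨G, c, d, hc, hd, ⟨hG, fun p hp => ⟨⟨(hGm p hp).1, ?_⟩, (hGm p hp).2⟩, by lia, hGc,
    by rw [hhinge d (by lia), hFd], Or.inr (by rw [hhinge _ (by lia), hFd'])⟩, fun k hak hkb => ?_⟩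
  · by_cases hap : a < p.1
    · obtain ⟨q, hq⟩ := mem_vertices.1 hp
      exact (hFm p (left_mem_vertices ((hFG p q hap).1 hq))).1
    · lia
  · refine oneBlockAt_congr fun p q hpq => ?_
    rcases hpq with h0 | h0
    · rw [hFG _ _ (by dsimp only; lia), hEF _ _ (by dsimp only; lia)]
    · rw [Sym2.eq_swap, hFG _ _ (by dsimp only; lia), hEF _ _ (by dsimp only; lia), Sym2.eq_swap]

open Classical in
/-- The edges of `E` to the left of the plane `x = c`, this plane included. -/
noncomputable def leftPart (c : ℤ) (E : Finset (Sym2 Point)) : Finset (Sym2 Point) :=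
  E.filter fun e => ∀ p ∈ e, p.1 ≤ c

open Classical in
/-- The left part of `A` and the right part of `B`, with respect to the plane `x = c`. -/
noncomputable def splice (c : ℤ) (A B : Finset (Sym2 Point)) : Finset (Sym2 Point) :=
  leftPart c A ∪ B.filter fun e => ∃ p ∈ e, c < p.1

lemma mem_leftPart {c : ℤ} {E : Finset (Sym2 Point)} {p q : Point} :
    s(p, q) ∈ leftPart c E ↔ s(p, q) ∈ E ∧ p.1 ≤ c ∧ q.1 ≤ c := by
  simp [leftPart]

lemma mem_splice {c : ℤ} {A B : Finset (Sym2 Point)} {p q : Point} :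
    s(p, q) ∈ splice c A B ↔
      (s(p, q) ∈ A ∧ p.1 ≤ c ∧ q.1 ≤ c) ∨ (s(p, q) ∈ B ∧ (c < p.1 ∨ c < q.1)) := by
  simp [splice, leftPart]

/-- What the right part of a polygon has to know about the left part: the 1-block at the cut, and
which of its vertices are connected in the left part. -/
def datum (c : ℤ) (E : Finset (Sym2 Point)) : OneBlock × Set ((ℤ × ℤ) × (ℤ × ℤ)) :=
  (oneBlockAt E c, {x | x.1 ∈ occupied E c ∧ x.2 ∈ occupied E c ∧
    Linked (leftPart c E) (c, x.1) (c, x.2)})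

section splice
variable {c : ℤ} {A B : Finset (Sym2 Point)}

lemma fst_le_succ {p q : Point} (h : cubicLattice.Adj p q) : q.1 ≤ p.1 + 1 := by
  have := adj_cases h
  lia

lemma mem_splice_of_lt (hA : IsLoop A) {p q : Point} (hp : p.1 < c) :
    s(p, q) ∈ splice c A B ↔ (s(p, q) ∈ A ∨ (s(p, q) ∈ B ∧ c < q.1)) := by
  rw [mem_splice]
  constructor
  · rintro (h | h)
    · exact Or.inl h.1
    · exact Or.inr ⟨h.1, by lia⟩
  · rintro (h | h)
    · have := fst_le_succ (hA.lattice h)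
      exact Or.inl ⟨h, by lia⟩
    · exact Or.inr ⟨h.1, by lia⟩

lemma mem_splice_left (hA : IsLoop A) (hB : IsLoop B) {p q : Point} (hp : p.1 < c) :
    s(p, q) ∈ splice c A B ↔ s(p, q) ∈ A := by
  rw [mem_splice_of_lt hA hp, or_iff_left]
  rintro ⟨h, hq⟩
  have := fst_le_succ (hB.lattice h)
  lia

lemma mem_splice_right (hA : IsLoop A) (hB : IsLoop B) (h : oneBlockAt A c = oneBlockAt B c)
    {p q : Point} (hp : c ≤ p.1) : s(p, q) ∈ splice c A B ↔ s(p, q) ∈ B := by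
  rw [mem_splice]
  rcases hp.eq_or_lt with hp | hp
  · rw [mem_iff_of_oneBlockAt_eq hA.lattice hB.lattice h hp.symm]
    constructor
    · tauto
    · intro hm
      by_cases hq : q.1 ≤ c
      · exact Or.inl ⟨hm, by lia, hq⟩
      · exact Or.inr ⟨hm, by lia⟩
  · constructor
    · rintro (h | h)
      · lia
      · exact h.1
    · exact fun h => Or.inr ⟨h, Or.inl hp⟩

lemma mem_vertices_splice_left (hA : IsLoop A) (hB : IsLoop B) {p : Point} (hp : p.1 < c) :
    p ∈ vertices (splice c A B) ↔ p ∈ vertices A := by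
  simp only [mem_vertices, mem_splice_left hA hB hp]

lemma mem_vertices_splice_right (hA : IsLoop A) (hB : IsLoop B)
    (h : oneBlockAt A c = oneBlockAt B c) {p : Point} (hp : c ≤ p.1) :
    p ∈ vertices (splice c A B) ↔ p ∈ vertices B := by
  simp only [mem_vertices, mem_splice_right hA hB h hp]

lemma mem_vertices_iff_of_oneBlockAt_eq (hA : IsLoop A) (hB : IsLoop B)
    (h : oneBlockAt A c = oneBlockAt B c) {p : Point} (hp : p.1 = c) :
    p ∈ vertices A ↔ p ∈ vertices B := by
  simp only [mem_vertices, mem_iff_of_oneBlockAt_eq hA.lattice hB.lattice h hp]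

/-- In the left part of a polygon, every vertex is connected with the plane of the cut. -/
lemma IsLoop.exists_linked_leftPart (hA : IsLoop A) {t : Point} (ht : t ∈ vertices A)
    (htc : t.1 = c) {q : Point} (hq : q ∈ vertices A) (hqc : q.1 ≤ c) :
    ∃ r ∈ vertices A, r.1 = c ∧ Linked (leftPart c A) r q := by
  have key : ∀ q, Linked A t q → q.1 ≤ c →
      ∃ r ∈ vertices A, r.1 = c ∧ Linked (leftPart c A) r q := by
    intro q hq
    induction hq with
    | refl => exact fun _ => ⟨t, ht, htc, ReflTransGen.refl⟩
    | @tail x y _ hxy ih =>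
      intro hy
      by_cases hyc : y.1 = c
      · exact ⟨y, right_mem_vertices hxy, hyc, ReflTransGen.refl⟩
      · have := fst_le_succ (hA.lattice hxy).symm
        obtain ⟨r, hr, hrc, hrx⟩ := ih (by lia)
        exact ⟨r, hr, hrc, hrx.tail (mem_leftPart.2 ⟨hxy, by lia, hy⟩)⟩
  exact key q (hA.linked t ht q hq) hqc

/-- If two polygons look the same at a cut, then the left part of the one can be spliced with the
right part of the other. -/
theorem isPolygon_splice (hA : IsPolygon A) (hB : IsPolygon B) (h : datum c A = datum c B)
    (hc : ∃ t ∈ vertices B, t.1 = c) : IsPolygon (splice c A B) := by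
  replace hA := hA.isLoop
  replace hB := hB.isLoop
  rw [datum, datum, Prod.mk.injEq] at h
  obtain ⟨hblock, hlink⟩ := h
  obtain ⟨t, ht, htc⟩ := hc
  have hleft : leftPart c A ⊆ splice c A B := Finset.subset_union_left
  have hlink' : ∀ {p q : Point}, p ∈ vertices B → q ∈ vertices B → p.1 = c → q.1 = c →
      Linked (leftPart c B) p q → Linked (leftPart c A) p q := by
    rintro ⟨x, u⟩ ⟨y, v⟩ hp hq rfl rfl hl
    exact ((Set.ext_iff.1 hlink (u, v)).2 ⟨hp, hq, hl⟩).2.2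
  have key : ∀ q, Linked B t q → (c ≤ q.1 → Linked (splice c A B) t q) ∧
      (q.1 ≤ c → ∃ r ∈ vertices B, r.1 = c ∧ Linked (splice c A B) t r ∧
        Linked (leftPart c B) r q) := by
    intro q hq
    induction hq with
    | refl => exact ⟨fun _ => ReflTransGen.refl,
        fun _ => ⟨t, ht, htc, ReflTransGen.refl, ReflTransGen.refl⟩⟩
    | @tail x y _ hxy ih =>
      by_cases hside : x.1 ≤ c ∧ y.1 ≤ c
      · obtain ⟨r, hr, hrc, htr, hrx⟩ := ih.2 hside.1
        have hry : Linked (leftPart c B) r y := hrx.tail (mem_leftPart.2 ⟨hxy, hside⟩)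
        refine ⟨fun hy => ?_, fun _ => ⟨r, hr, hrc, htr, hry⟩⟩
        exact htr.trans ((hlink' hr (right_mem_vertices hxy) hrc (by lia) hry).mono hleft)
      · have h1 := fst_le_succ (hB.lattice hxy)
        have h2 := fst_le_succ (hB.lattice hxy).symm
        have hty : Linked (splice c A B) t y :=
          (ih.1 (by lia)).tail ((mem_splice_right hA hB hblock (by lia)).2 hxy)
        exact ⟨fun _ => hty, fun hy => ⟨y, right_mem_vertices hxy, by lia, hty, ReflTransGen.refl⟩⟩
  have hconn : ∀ q ∈ vertices (splice c A B), Linked (splice c A B) t q := by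
    intro q hq
    by_cases hqc : c ≤ q.1
    · rw [mem_vertices_splice_right hA hB hblock hqc] at hq
      exact (key q (hB.linked t ht q hq)).1 hqc
    · rw [mem_vertices_splice_left hA hB (by lia)] at hq
      obtain ⟨r, hr, hrc, hrq⟩ := hA.exists_linked_leftPart
        ((mem_vertices_iff_of_oneBlockAt_eq hA hB hblock htc).2 ht) htc hq (by lia)
      rw [mem_vertices_iff_of_oneBlockAt_eq hA hB hblock hrc] at hr
      exact ((key r (hB.linked t ht r hr)).1 hrc.ge).trans (hrq.mono hleft)
  refine IsLoop.isPolygon ⟨?_, ?_, ?_, fun p hp q hq => (hconn p hp).symm.trans (hconn q hq)⟩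
  · intro p q hpq
    rcases mem_splice.1 hpq with h | h
    · exact hA.lattice h.1
    · exact hB.lattice h.1
  · obtain ⟨q, hq⟩ := mem_vertices.1 ht
    exact ⟨_, (mem_splice_right hA hB hblock htc.ge).2 hq⟩
  · intro p hp
    by_cases hpc : c ≤ p.1
    · simp only [mem_splice_right hA hB hblock hpc]
      exact hB.degree p ((mem_vertices_splice_right hA hB hblock hpc).1 hp)
    · simp only [mem_splice_left hA hB (lt_of_not_ge hpc)]
      exact hA.degree p ((mem_vertices_splice_left hA hB (lt_of_not_ge hpc)).1 hp)

lemma oneBlockAt_splice_right (hA : IsLoop A) (hB : IsLoop B)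
    (h : oneBlockAt A c = oneBlockAt B c) {k : ℤ} (hk : c ≤ k) :
    oneBlockAt (splice c A B) k = oneBlockAt B k := by
  refine oneBlockAt_congr fun p q hpq => ?_
  rcases hpq with h0 | h0
  · rw [mem_splice_right hA hB h (by dsimp only; lia)]
  · rw [Sym2.eq_swap, mem_splice_right hA hB h (by dsimp only; lia), Sym2.eq_swap]

lemma oneBlockAt_splice_left (hA : IsLoop A) (hB : IsLoop B)
    (h : oneBlockAt A c = oneBlockAt B c) {k : ℤ} (hk : k ≤ c) :
    oneBlockAt (splice c A B) k = oneBlockAt A k := by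
  rcases hk.eq_or_lt with rfl | hk
  · rw [oneBlockAt_splice_right hA hB h le_rfl, h]
  refine oneBlockAt_congr fun p q hpq => ?_
  rcases hpq with h0 | h0
  · rw [mem_splice_left hA hB (by dsimp only; lia)]
  · rw [Sym2.eq_swap, mem_splice_left hA hB (by dsimp only; lia), Sym2.eq_swap]

lemma Capped.splice {L M : ℕ} {a b a' b' : ℤ} (hA : Capped L M a b A) (hB : Capped L M a' b' B)
    (h : datum c A = datum c B) (ha : a < c) (ha' : a' < c) (hb' : c < b') :
    Capped L M a b' (splice c A B) := by
  have hAl := hA.polygon.isLoop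
  have hBl := hB.polygon.isLoop
  have hblock : oneBlockAt A c = oneBlockAt B c := (Prod.ext_iff.1 h).1
  have hc : ∃ t ∈ vertices B, t.1 = c :=
    hBl.exists_mem_plane (left_mem_vertices (capAt_mem hB.left))
      (left_mem_vertices (capAt_mem hB.right)) ha'.le hb'.le
  refine ⟨isPolygon_splice hA.polygon hB.polygon h hc, fun p hp => ?_, by lia, ?_, ?_, Or.inr ?_⟩
  · by_cases hpc : c ≤ p.1
    · have := hB.mem p ((mem_vertices_splice_right hAl hBl hblock hpc).1 hp)
      exact ⟨by lia, this.2⟩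
    · have := hA.mem p ((mem_vertices_splice_left hAl hBl (lt_of_not_ge hpc)).1 hp)
      exact ⟨by lia, this.2⟩
  · rw [oneBlockAt_splice_left hAl hBl hblock ha.le, hA.left]
  · rw [oneBlockAt_splice_right hAl hBl hblock hb'.le, hB.right]
  · rw [oneBlockAt_splice_right hAl hBl hblock (by lia)]
    exact hB.penultimate.resolve_left (by lia)

end splice

lemma linked_shiftEdges {d : ℤ} {E : Finset (Sym2 Point)} {p q : Point} (h : Linked E p q) :
    Linked (shiftEdges d E) (shift d p) (shift d q) := by
  refine ReflTransGen.lift (shift d) (fun p q hpq => ?_) _ _ h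
  exact Finset.mem_image_of_mem (Sym2.map (shift d)) hpq

lemma shiftEdges_shiftEdges (d d' : ℤ) (E : Finset (Sym2 Point)) :
    shiftEdges d (shiftEdges d' E) = shiftEdges (d + d') E := by
  ext e
  induction e with | _ p q
  simp only [mem_shiftEdges, sub_sub]

lemma shiftEdges_zero (E : Finset (Sym2 Point)) : shiftEdges 0 E = E := by
  ext e
  induction e with | _ p q
  simp only [mem_shiftEdges, sub_zero]

lemma leftPart_shiftEdges (c d : ℤ) (E : Finset (Sym2 Point)) :
    leftPart (c + d) (shiftEdges d E) = shiftEdges d (leftPart c E) := by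
  ext e
  induction e with | _ p q
  simp only [mem_leftPart, mem_shiftEdges, sub_le_iff_le_add]

lemma datum_shiftEdges (c d : ℤ) (E : Finset (Sym2 Point)) :
    datum (c + d) (shiftEdges d E) = datum c E := by
  rw [datum, datum, oneBlockAt_shiftEdges, add_sub_cancel_right, leftPart_shiftEdges]
  congr 1
  ext ⟨u, v⟩
  simp only [Set.mem_ofPred_eq, occupied, mem_vertices_shiftEdges, add_sub_cancel_right]
  refine and_congr_right fun _ => and_congr_right fun _ => ⟨fun h => ?_, fun h => ?_⟩
  · have := linked_shiftEdges (d := -d) h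
    rw [shiftEdges_shiftEdges, neg_add_cancel, shiftEdges_zero] at this
    simpa [shift] using this
  · exact linked_shiftEdges (d := d) h

lemma datum_mem {L M : ℕ} {a b : ℤ} {E : Finset (Sym2 Point)} (h : Capped L M a b E) (c : ℤ) :
    datum c E ∈ crossBlocks L M ×ˢ 𝒫 ((cross L M : Set (ℤ × ℤ)) ×ˢ (cross L M : Set (ℤ × ℤ))) := by
  refine ⟨⟨?_, ?_, ?_⟩, ?_⟩
  · intro e he
    induction e with | _ u v
    rw [Finset.mem_coe, Finset.mk_mem_sym2_iff]
    exact ⟨(h.mem _ (left_mem_vertices he)).2, (h.mem _ (right_mem_vertices he)).2⟩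
  · exact fun u hu => (h.mem _ (right_mem_vertices hu)).2
  · exact fun u hu => (h.mem _ (left_mem_vertices hu)).2
  · exact fun x hx => ⟨(h.mem _ hx.1).2, (h.mem _ hx.2.1).2⟩

/-- All the data at cuts are realized by polygons of bounded span. -/
lemma exists_bounded_datum (L M : ℕ) : ∃ C : ℕ, ∀ (a b c : ℤ) (E : Finset (Sym2 Point)),
    Capped L M a b E → a < c → c < b → ∃ a' b' F, Capped L M a' b' F ∧ a' < c ∧ c < b' ∧
      c - C ≤ a' ∧ b' ≤ c + C ∧ datum c F = datum c E := by
  set R : Set (ℤ × ℤ × Finset (Sym2 Point)) :=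
    {x | Capped L M x.1 x.2.1 x.2.2 ∧ x.1 < 0 ∧ 0 < x.2.1} with hR
  have hfin : ((fun x : ℤ × ℤ × Finset (Sym2 Point) => datum 0 x.2.2) '' R).Finite := by
    refine ((crossBlocks_finite L M).prod
      (((cross L M).finite_toSet.prod (cross L M).finite_toSet).finite_subsets)).subset ?_
    rintro _ ⟨x, hx, rfl⟩
    exact datum_mem hx.1 0
  choose! f hf using fun (δ) (hδ : δ ∈ (fun x : ℤ × ℤ × Finset (Sym2 Point) => datum 0 x.2.2) '' R)
    => hδ
  obtain ⟨C, hC⟩ := (hfin.image fun δ => (f δ).2.1 - (f δ).1).bddAbove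
  refine ⟨C.toNat, fun a b c E hE hac hcb => ?_⟩
  have hmem : ((a - c, b - c, shiftEdges (-c) E) : ℤ × ℤ × Finset (Sym2 Point)) ∈ R := by
    refine ⟨hE.shiftEdges (-c), ?_, ?_⟩ <;> dsimp only <;> lia
  have hδ := Set.mem_image_of_mem (fun x : ℤ × ℤ × Finset (Sym2 Point) => datum 0 x.2.2) hmem
  obtain ⟨⟨h1, h2, h3⟩, h4⟩ := hf _ hδ
  have h5 := hC ⟨_, hδ, rfl⟩
  dsimp only at h1 h2 h3 h4 h5
  set x := f (datum 0 (shiftEdges (-c) E))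
  refine ⟨x.1 + c, x.2.1 + c, shiftEdges c x.2.2, h1.shiftEdges c, by lia, by lia, by lia, by lia,
    ?_⟩
  have h6 := datum_shiftEdges 0 c x.2.2
  have h7 := datum_shiftEdges c (-c) E
  rw [zero_add] at h6
  rw [add_neg_cancel] at h7
  rw [h6, h4, h7]

/-- The two ends of a polygon can be replaced by ends of bounded span. -/
lemma exists_bounded_capped (L M : ℕ) : ∃ C : ℕ, ∀ (a b c d : ℤ) (E : Finset (Sym2 Point)),
    Capped L M a b E → a < c → c ≤ d → d < b → ∃ a' b' F, Capped L M a' b' F ∧ a' < c ∧ d < b' ∧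
      c - C ≤ a' ∧ b' ≤ d + C ∧ ∀ k, c ≤ k → k ≤ d → oneBlockAt F k = oneBlockAt E k := by
  obtain ⟨C, hC⟩ := exists_bounded_datum L M
  refine ⟨C, fun a b c d E hE hac hcd hdb => ?_⟩
  obtain ⟨a₁, b₁, F, hF, ha₁, hb₁, haC, -, hdF⟩ := hC a b c E hE hac (by lia)
  have hS := hF.splice hE hdF ha₁ hac (by lia)
  obtain ⟨a₂, b₂, G, hG, ha₂, hb₂, -, hbC, hdG⟩ := hC _ _ d _ hS (by lia) (by lia)
  refine ⟨a₁, b₂, _, hS.splice hG hdG.symm (by lia) ha₂ hb₂, ha₁, hb₂, haC, hbC, fun k hck hkd => ?_⟩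
  rw [oneBlockAt_splice_left hS.polygon.isLoop hG.polygon.isLoop (Prod.ext_iff.1 hdG.symm).1 hkd,
    oneBlockAt_splice_right hF.polygon.isLoop hE.polygon.isLoop (Prod.ext_iff.1 hdF).1 hck]

/-- The interior of a full block occurs in a polygon with prescribed ends whose span exceeds the
span of the block by a bounded amount. -/
theorem exists_bounded_extension {L : ℕ} (M : ℕ) (hL : 0 < L) : ∃ C : ℕ, ∀ s : ℕ, 1 ≤ s →
    ∀ b ∈ blocks L M (s + 2), ∃ i j : ℕ, j ≤ i ∧ i ≤ C ∧ ∃ E, Capped L M 0 (s + i : ℕ) E ∧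
      ∀ l : ℕ, ∀ hl : l < s, oneBlockAt E (j + l : ℕ) = b ⟨l + 1, by lia⟩ := by
  obtain ⟨C, hC⟩ := exists_bounded_capped L M
  refine ⟨2 * C, fun s hs b hb => ?_⟩
  obtain ⟨E, hE, k, hk⟩ := hb
  obtain ⟨p₀, hp₀, hp₀k⟩ := (hk ⟨0, by lia⟩).1
  obtain ⟨p₁, hp₁, hp₁k⟩ := (hk ⟨s + 1, by lia⟩).1
  have hk0 := (mem_tube.1 (hE.2.1 hp₀)).1
  obtain ⟨m, hm, hmax⟩ := (vertexFinset E).exists_max_image (fun p => p.1)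
    ⟨p₀, mem_vertexFinset.2 hp₀⟩
  have hm1 := hmax p₁ (mem_vertexFinset.2 hp₁)
  dsimp only at hp₀k hp₁k
  push_cast at hp₀k hp₁k
  obtain ⟨F, c, d, hc, hd, hF, hFE⟩ := exists_capped hL hE.1 (a := 0) (b := m.1) (by lia)
    (fun p hp => ⟨⟨(mem_tube.1 (hE.2.1 hp)).1, hmax p (mem_vertexFinset.2 hp)⟩,
      (mem_tube.1 (hE.2.1 hp)).2⟩) hE.2.2 ⟨m, mem_vertexFinset.1 hm, rfl⟩
  obtain ⟨a', b', G, hG, ha', hb', haC, hbC, hGF⟩ := hC c d (k + 1) (k + s) F hF (by lia) (by lia)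
    (by lia)
  refine ⟨(b' - a' - s).toNat, (k + 1 - a').toNat, by lia, by lia, shiftEdges (-a') G, ?_,
    fun l hl => ?_⟩
  · have := hG.shiftEdges (-a')
    rw [add_neg_cancel] at this
    rwa [show ((s + (b' - a' - s).toNat : ℕ) : ℤ) = b' + -a' by lia]
  · rw [oneBlockAt_shiftEdges, show (((k + 1 - a').toNat + l : ℕ) : ℤ) - -a' = k + (l + 1) by lia,
      hGF _ (by lia) (by lia), hFE _ (by lia) (by lia), (hk ⟨l + 1, by lia⟩).2]
    simp

section comb
variable {u : ℕ → ℤ × ℤ} {N : ℕ}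

/-- The rectangle of width `n` over the edge `v, w`. -/
lemma exists_rectangle {v w : ℤ × ℤ} (h : cubicLattice.Adj (0, v) (0, w)) (n : ℕ) :
    ∃ E, IsPolygon E ∧ (∀ p, p ∈ vertices E ↔ (0 ≤ p.1 ∧ p.1 ≤ n + 1) ∧ (p.2 = v ∨ p.2 = w)) ∧
      s(((n + 1 : ℤ), v), ((n + 1 : ℤ), w)) ∈ E ∧
      ∀ x : ℤ, 0 ≤ x → x ≤ n → s((x, w), (x + 1, w)) ∈ E := by
  have hvw : v ≠ w := fun hvw => h.ne (by rw [hvw])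
  induction n with
  | zero =>
    refine ⟨square (0, v) (0, w) (1, w) (1, v), isPolygon_square h (adj_succ 0 w)
      (adj_translate 1 h).symm (adj_succ 0 v).symm (by simp) (by simp), fun p => ?_, ?_, ?_⟩
    · obtain ⟨x, y⟩ := p
      rw [vertices_square]
      simp only [Prod.mk.injEq, Nat.cast_zero]
      constructor
      · rintro (⟨rfl, rfl⟩ | ⟨rfl, rfl⟩ | ⟨rfl, rfl⟩ | ⟨rfl, rfl⟩) <;> simp
      · rintro ⟨⟨h1, h2⟩, h3⟩
        rcases (show x = 0 ∨ x = 1 by lia) with rfl | rfl <;> tauto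
    · simp [square]
    · intro x h1 h2
      obtain rfl : x = 0 := by
        push_cast at h2
        lia
      simp [square]
  | succ n ih =>
    obtain ⟨E, hE, hV, he, hx⟩ := ih
    have hfree : ∀ y : ℤ × ℤ, (((n : ℤ) + 1 + 1, y) : Point) ∉ vertices E := by
      intro y hy
      have := ((hV _).1 hy).1.2
      dsimp only at this
      lia
    have hadj := adj_translate (n + 1 + 1) h
    refine ⟨prolong E (n + 1) v w, isPolygon_attach hE he (adj_succ _ w) hadj.symm
      (adj_succ _ v).symm (hfree w) (hfree v), fun p => ?_, ?_, ?_⟩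
    · rw [prolong, vertices_attach he (hfree w) (hfree v), hV]
      obtain ⟨x, y⟩ := p
      simp only [Prod.mk.injEq]
      push_cast
      constructor
      · rintro (h | ⟨rfl, rfl⟩ | ⟨rfl, rfl⟩)
        · exact ⟨by lia, h.2⟩
        · exact ⟨by lia, Or.inr rfl⟩
        · exact ⟨by lia, Or.inl rfl⟩
      · rintro ⟨h1, h2⟩
        by_cases hxn : x ≤ n + 1
        · exact Or.inl ⟨⟨h1.1, hxn⟩, h2⟩
        · have : x = n + 1 + 1 := by lia
          tauto
    · rw [prolong, mem_attach, ne_eq, Sym2.eq_iff]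
      push_cast
      refine ⟨by simp, Or.inr (Or.inr (Or.inl Sym2.eq_swap))⟩
    · intro x h1 h2
      push_cast at h2
      rw [prolong, mem_attach, ne_eq, Sym2.eq_iff]
      refine ⟨by simp [hvw.symm], ?_⟩
      by_cases hxn : x ≤ n
      · exact Or.inl (hx x h1 hxn)
      · obtain rfl : x = n + 1 := by lia
        exact Or.inr (Or.inl rfl)

/-- A path in the cross-section gives a polygon which visits all the vertices over this path in
`2 m` consecutive planes. -/
lemma exists_comb (hinj : ∀ i ≤ N, ∀ j ≤ N, u i = u j → i = j)
    (hadj : ∀ i < N, cubicLattice.Adj (0, u i) (0, u (i + 1))) (m : ℕ) (hm : 1 ≤ m) (j : ℕ)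
    (hj1 : 1 ≤ j) (hj : j ≤ N) :
    ∃ E, IsPolygon E ∧
      (∀ p, p ∈ vertices E ↔ (0 ≤ p.1 ∧ p.1 < 2 * m) ∧ ∃ i ≤ j, p.2 = u i) ∧
      ∀ x : ℕ, x < m → s(((2 * x : ℤ), u j), ((2 * x + 1 : ℤ), u j)) ∈ E := by
  induction j, hj1 using Nat.le_induction with
  | base =>
    obtain ⟨E, hE, hV, -, hx⟩ := exists_rectangle (hadj 0 (by lia)) (2 * m - 2)
    refine ⟨E, hE, fun p => ?_, fun x hxm => hx _ (by lia) (by lia)⟩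
    rw [hV]
    refine and_congr (by lia) ⟨?_, ?_⟩
    · rintro (h | h)
      · exact ⟨0, by lia, h⟩
      · exact ⟨1, le_rfl, h⟩
    · rintro ⟨i, hi, h⟩
      rcases (show i = 0 ∨ i = 1 by lia) with rfl | rfl
      · exact Or.inl h
      · exact Or.inr h
  | succ j hj1 ih =>
    obtain ⟨E, hE, hV, hx⟩ := ih (by lia)
    have hne : u j ≠ u (j + 1) := fun h => by
      have := hinj j (by lia) (j + 1) hj h
      lia
    have key : ∀ t ≤ m, ∃ F, IsPolygon F ∧
        (∀ p, p ∈ vertices F ↔ p ∈ vertices E ∨ ((0 ≤ p.1 ∧ p.1 < 2 * t) ∧ p.2 = u (j + 1))) ∧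
        (∀ x : ℕ, x < t → s(((2 * x : ℤ), u (j + 1)), ((2 * x + 1 : ℤ), u (j + 1))) ∈ F) ∧
        ∀ x : ℕ, t ≤ x → x < m → s(((2 * x : ℤ), u j), ((2 * x + 1 : ℤ), u j)) ∈ F := by
      intro t ht
      induction t with
      | zero =>
        refine ⟨E, hE, fun p => ?_, fun x hx => by lia, fun x _ hxm => hx x hxm⟩
        rw [iff_self_or]
        intro h
        push_cast at h
        lia
      | succ t ih =>
        obtain ⟨F, hF, hFV, hF1, hF2⟩ := ih (by lia)
        have hfree : ∀ x : ℤ, 2 * t ≤ x → ((x, u (j + 1)) : Point) ∉ vertices F := by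
          intro x hx hmem
          rw [hFV, hV] at hmem
          rcases hmem with ⟨-, i, hi, h⟩ | ⟨h, -⟩
          · have := hinj _ hj i (by lia) h
            lia
          · dsimp only at h
            lia
        have he := hF2 t le_rfl (by lia)
        have ha := hadj j (by lia)
        refine ⟨attach F (2 * t, u j) (2 * t + 1, u j) (2 * t + 1, u (j + 1)) (2 * t, u (j + 1)),
          isPolygon_attach hF he (adj_translate _ ha) (adj_succ _ _).symm (adj_translate _ ha).symm
            (hfree _ (by lia)) (hfree _ (by lia)), fun p => ?_, fun x hx => ?_, fun x hx hxm => ?_⟩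
        · rw [vertices_attach he (hfree _ (by lia)) (hfree _ (by lia)), hFV]
          obtain ⟨y, v⟩ := p
          simp only [Prod.mk.injEq]
          push_cast
          constructor
          · rintro ((h | h) | ⟨rfl, rfl⟩ | ⟨rfl, rfl⟩)
            · exact Or.inl h
            · exact Or.inr ⟨by lia, h.2⟩
            · exact Or.inr ⟨by lia, rfl⟩
            · exact Or.inr ⟨by lia, rfl⟩
          · rintro (h | ⟨h1, h2⟩)
            · exact Or.inl (Or.inl h)
            · rcases (show y < 2 * t ∨ y = 2 * t + 1 ∨ y = 2 * t by lia) with h | h | h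
              · exact Or.inl (Or.inr ⟨⟨h1.1, h⟩, h2⟩)
              · exact Or.inr (Or.inl ⟨h, h2⟩)
              · exact Or.inr (Or.inr ⟨h, h2⟩)
        · rw [mem_attach, ne_eq, Sym2.eq_iff]
          refine ⟨by simp [hne.symm], ?_⟩
          rcases (show x < t ∨ x = t by lia) with h | rfl
          · exact Or.inl (hF1 x h)
          · exact Or.inr (Or.inr (Or.inl Sym2.eq_swap))
        · rw [mem_attach, ne_eq, Sym2.eq_iff]
          refine ⟨?_, Or.inl (hF2 x (by lia) hxm)⟩
          simp only [Prod.mk.injEq]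
          lia
    obtain ⟨F, hF, hFV, hF1, -⟩ := key m le_rfl
    refine ⟨F, hF, fun p => ?_, hF1⟩
    rw [hFV, hV]
    constructor
    · rintro (⟨h, i, hi, hp⟩ | ⟨h, hp⟩)
      · exact ⟨h, i, by lia, hp⟩
      · exact ⟨h, j + 1, le_rfl, hp⟩
    · rintro ⟨h, i, hi, hp⟩
      rcases hi.eq_or_lt with rfl | hi
      · exact Or.inr ⟨h, hp⟩
      · exact Or.inl ⟨h, i, by lia, hp⟩

end comb

/-- The boustrophedon path through the cross-section. -/
def snake (L n : ℕ) : ℤ × ℤ :=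
  (if Even (n / (L + 1)) then ((n % (L + 1) : ℕ) : ℤ) else L - (n % (L + 1) : ℕ), (n / (L + 1) : ℕ))

lemma snake_mem {L M n : ℕ} (hn : n < W L M) : snake L n ∈ cross L M := by
  have h1 : n % (L + 1) < L + 1 := Nat.mod_lt _ (by lia)
  have h2 : n / (L + 1) < M + 1 := Nat.div_lt_of_lt_mul hn
  rw [mem_cross, snake]
  dsimp only
  split_ifs <;> lia

lemma snake_injective (L : ℕ) : Function.Injective (snake L) := by
  intro m n h
  rw [snake, snake, Prod.mk.injEq] at h
  obtain ⟨h1, h2⟩ := h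
  have hd : m / (L + 1) = n / (L + 1) := by exact_mod_cast h2
  have hr : m % (L + 1) = n % (L + 1) := by
    rw [hd] at h1
    split_ifs at h1 <;> lia
  rw [← Nat.div_add_mod m (L + 1), ← Nat.div_add_mod n (L + 1), hd, hr]

lemma snake_adj (L n : ℕ) : cubicLattice.Adj (0, snake L n) (0, snake L (n + 1)) := by
  rw [adj_iff, snake, snake]
  have h1 : n % (L + 1) < L + 1 := Nat.mod_lt _ (by lia)
  have e1 := Nat.div_add_mod n (L + 1)
  have e2 := Nat.div_add_mod (n + 1) (L + 1)
  by_cases h : L + 1 ∣ n + 1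
  · have hd : (n + 1) / (L + 1) = n / (L + 1) + 1 := Nat.succ_div_of_dvd h
    have hm : (n + 1) % (L + 1) = 0 := Nat.mod_eq_zero_of_dvd h
    have hn : n % (L + 1) = L := by
      rw [hd, hm, mul_add] at e2
      lia
    rw [hd, hm, hn]
    simp only [Nat.even_add_one]
    by_cases he : Even (n / (L + 1)) <;> simp [he]
  · have hd : (n + 1) / (L + 1) = n / (L + 1) := Nat.succ_div_of_not_dvd h
    have hm : (n + 1) % (L + 1) = n % (L + 1) + 1 := by
      rw [hd] at e2
      lia
    rw [hd, hm]
    by_cases he : Even (n / (L + 1)) <;> simp [he]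

lemma exists_snake_eq {L M : ℕ} {v : ℤ × ℤ} (hv : v ∈ cross L M) :
    ∃ n < W L M, v = snake L n := by
  have h : (Finset.range (W L M)).image (snake L) = cross L M := by
    refine Finset.eq_of_subset_of_card_le (fun v hv => ?_) ?_
    · obtain ⟨n, hn, rfl⟩ := Finset.mem_image.1 hv
      exact snake_mem (Finset.mem_range.1 hn)
    · rw [Finset.card_image_of_injective _ (snake_injective L), card_cross, Finset.card_range]
  rw [← h] at hv
  obtain ⟨n, hn, rfl⟩ := Finset.mem_image.1 hv
  exact ⟨n, Finset.mem_range.1 hn, rfl⟩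

/-- There are full blocks of every span. -/
theorem fullBlocks_nonempty {L : ℕ} (M : ℕ) (hL : 0 < L) (s : ℕ) : (fullBlocks L M s).Nonempty := by
  have hW : 2 ≤ W L M := by
    rw [W]
    nlinarith
  obtain ⟨E, hE, hV, -⟩ := exists_comb (u := snake L) (N := W L M - 1)
    (fun i _ j _ h => snake_injective L h) (fun i _ => snake_adj L i) (s + 1) (by lia)
    (W L M - 1) (by lia) le_rfl
  have hocc : ∀ (x : ℤ) (v : ℤ × ℤ), 0 ≤ x → x ≤ s → v ∈ cross L M →
      ((x, v) : Point) ∈ vertices E := by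
    intro x v h1 h2 hv
    obtain ⟨n, hn, rfl⟩ := exists_snake_eq hv
    exact (hV _).2 ⟨by dsimp only; lia, n, by lia, rfl⟩
  have h0 : ((0, 0) : ℤ × ℤ) ∈ cross L M := by simp [mem_cross]
  have hT : E ∈ tubePolygons L M := by
    refine ⟨hE, fun p hp => ?_, (0, 0, 0), hocc 0 _ le_rfl (by lia) h0, rfl⟩
    obtain ⟨h1, n, hn, h2⟩ := (hV p).1 hp
    exact mem_tube.2 ⟨h1.1, h2 ▸ snake_mem (by lia)⟩
  refine ⟨fun i => oneBlockAt E (0 + (i : ℕ)), ⟨E, hT, 0, fun i => ⟨?_, rfl⟩⟩, fun i => ?_⟩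
  · have := i.2
    exact ⟨_, hocc (0 + (i : ℕ)) _ (by lia) (by lia) h0, rfl⟩
  · have := i.2
    rw [length_oneBlockAt_eq_iff hT]
    exact (occupied_subset hT.2.1 _).antisymm fun v hv => hocc _ _ (by lia) (by lia) hv

lemma le_card_of_full {L M s S j : ℕ} (hj : j + s ≤ S) {E : Finset (Sym2 Point)}
    (h : Capped L M 0 S E)
    (hfull : ∀ l < s, (oneBlockAt E (j + l : ℕ)).length = W L M) : W L M * s ≤ E.card := by
  have h1 := card_eq_sum_length h.mem_tubePolygons.1 h.mem_tubePolygons.2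
  have h2 : (∑ l ∈ Finset.range s, (oneBlockAt E (j + l : ℕ)).length) ≤
      ∑ i ∈ Finset.range (S + 1), (oneBlockAt E i).length := by
    rw [← Finset.sum_image (s := Finset.range s) (g := fun l => j + l)
      (f := fun i : ℕ => (oneBlockAt E i).length) (fun a _ b _ h => by simpa using h)]
    refine Finset.sum_le_sum_of_subset_of_nonneg (fun i hi => ?_) fun i _ _ => ?_
    · simp only [Finset.mem_image, Finset.mem_range] at hi ⊢
      lia
    · rw [h.polygon.isLoop.length_oneBlockAt]
      positivity
  rw [Finset.sum_congr rfl fun l hl => hfull l (Finset.mem_range.1 hl), Finset.sum_const,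
    Finset.card_range, nsmul_eq_mul, ← h1] at h2
  rw [mul_comm]
  exact_mod_cast h2

/-- Full blocks are bounded in number by polygons with prescribed ends. -/
lemma exists_card_fullBlocks_le {L : ℕ} (M : ℕ) (hL : 0 < L) : ∃ C N : ℕ, ∀ s : ℕ, 1 ≤ s →
    ∀ z : ℝ, 0 ≤ z → ((fullBlocks L M (s + 2)).ncard : ℝ) * Real.exp (z * (W L M * s)) ≤
      N * ∑ i ∈ Finset.range (C + 1), cappedSum L M (s + i) z := by
  obtain ⟨C, hC⟩ := exists_bounded_extension M hL
  set B := (crossBlocks_finite L M).toFinset with hB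
  refine ⟨C, (B ×ˢ B ×ˢ Finset.range (C + 1)).card, fun s hs z hz => ?_⟩
  choose! i j hji hiC E hE hblock using hC s hs
  have hrhs : ((B ×ˢ B ×ˢ Finset.range (C + 1)).card : ℝ) *
      ∑ i ∈ Finset.range (C + 1), cappedSum L M (s + i) z =
      ∑ x ∈ (B ×ˢ B ×ˢ Finset.range (C + 1)) ×ˢ (Finset.range (C + 1)).sigma
        (fun i => (capped_finite L M (s + i)).toFinset), Real.exp (z * x.2.2.card) := by
    rw [Finset.sum_product]
    dsimp only
    rw [Finset.sum_const, nsmul_eq_mul, Finset.sum_sigma]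
    rfl
  have hlhs : ((fullBlocks L M (s + 2)).ncard : ℝ) * Real.exp (z * (W L M * s)) =
      ∑ b ∈ (fullBlocks_finite L M (s + 2)).toFinset, Real.exp (z * (W L M * s)) := by
    rw [Finset.sum_const, nsmul_eq_mul, Set.ncard_eq_toFinset_card _ (fullBlocks_finite L M _)]
  rw [hrhs, hlhs]
  have hmemB : ∀ b ∈ blocks L M (s + 2), ∀ l, b l ∈ B := by
    rintro b ⟨F, hF, k, hk⟩ l
    rw [hB, Set.Finite.mem_toFinset, (hk l).2]
    exact oneBlockAt_mem_crossBlocks hF.2.1 _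
  refine sum_le_sum_of_injOn
    (fun b => ((b ⟨0, by lia⟩, b ⟨s + 1, by lia⟩, j b), ⟨i b, E b⟩)) (fun b hb => ?_)
    (fun b hb b' hb' heq => ?_) (fun b hb => ?_) fun _ _ => (Real.exp_pos _).le
  · have hb' := ((Set.Finite.mem_toFinset _).1 hb).1
    have h1 := hji b hb'
    have h2 := hiC b hb'
    simp only [Finset.mem_product, Finset.mem_sigma, Finset.mem_range, Set.Finite.mem_toFinset]
    exact ⟨⟨hmemB b hb' _, hmemB b hb' _, by lia⟩, by lia, hE b hb'⟩
  · have hb1 := ((Set.Finite.mem_toFinset _).1 hb).1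
    have hb2 := ((Set.Finite.mem_toFinset _).1 hb').1
    simp only [Prod.mk.injEq, Sigma.mk.injEq] at heq
    obtain ⟨⟨h0, h1, hj⟩, hi, hE'⟩ := heq
    have hE' := eq_of_heq hE'
    funext ⟨l, hl⟩
    rcases (show l = 0 ∨ l = s + 1 ∨ ∃ l' < s, l = l' + 1 from by
      rcases l with _ | l
      · exact Or.inl rfl
      · by_cases h : l < s
        · exact Or.inr (Or.inr ⟨l, h, rfl⟩)
        · exact Or.inr (Or.inl (by lia))) with rfl | rfl | ⟨l', hl', rfl⟩
    · exact h0
    · exact h1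
    · rw [← hblock b hb1 l' hl', ← hblock b' hb2 l' hl', hE', hj]
  · have hb' := (Set.Finite.mem_toFinset _).1 hb
    refine Real.exp_le_exp.2 (mul_le_mul_of_nonneg_left ?_ hz)
    have := le_card_of_full (j := j b) (s := s) (S := s + i b)
      (by have := hji b hb'.1; lia) (hE b hb'.1) fun l hl => by
        rw [hblock b hb'.1 l hl]
        exact hb'.2 _
    exact_mod_cast this

lemma log_ncard_fullBlocks_nonneg (L M s : ℕ) :
    0 ≤ Real.log ((fullBlocks L M s).ncard : ℝ) := Real.log_natCast_nonneg _

lemma ncard_fullBlocks_pos {L : ℕ} (M : ℕ) (hL : 0 < L) (s : ℕ) :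
    (0 : ℝ) < (fullBlocks L M s).ncard := by
  exact_mod_cast (Set.ncard_pos (fullBlocks_finite L M s)).2 (fullBlocks_nonempty M hL s)

theorem betaFull_le {L : ℕ} (M : ℕ) (hL : 0 < L) {z : ℝ} (hz : 0 ≤ z) :
    betaFull L M + W L M * z ≤ dualFreeEnergy L M z := by
  obtain ⟨C, N, hCN⟩ := exists_card_fullBlocks_le M hL
  set G := dualFreeEnergy L M z with hG
  set K : ℝ := N * ∑ i ∈ Finset.range (C + 1), Real.exp (2 * z + i * G) with hK
  have hbound : ∀ s : ℕ, 1 ≤ s →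
      Real.log ((fullBlocks L M (s + 2)).ncard : ℝ) + W L M * z * s ≤ Real.log K + s * G := by
    intro s hs
    have hb := ncard_fullBlocks_pos M hL (s + 2)
    have h1 : ((fullBlocks L M (s + 2)).ncard : ℝ) * Real.exp (z * (W L M * s)) ≤
        K * Real.exp (s * G) := by
      refine (hCN s hs z hz).trans ?_
      rw [hK, mul_assoc, Finset.sum_mul]
      refine mul_le_mul_of_nonneg_left (Finset.sum_le_sum fun i _ => ?_) N.cast_nonneg
      rw [← Real.exp_add, ← Real.log_le_iff_le_exp (cappedSum_pos hL (by lia) z)]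
      have := (tendsto_dualFreeEnergy M hL z).2 (s + i) (by lia)
      push_cast at this
      rw [← hG] at this
      linarith
    have hpos := mul_pos hb (Real.exp_pos (z * (W L M * s)))
    have hKpos : 0 < K := pos_of_mul_pos_left (hpos.trans_le h1) (Real.exp_pos _).le
    have h2 := Real.log_le_log hpos h1
    rw [Real.log_mul hb.ne' (Real.exp_pos _).ne', Real.log_exp,
      Real.log_mul hKpos.ne' (Real.exp_pos _).ne', Real.log_exp] at h2
    linarith
  have hβ := (tendsto_betaFull L M).comp (tendsto_add_atTop_nat 2)
  have hC : Tendsto (fun s : ℕ => Real.log K / s) atTop (𝓝 0) :=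
    tendsto_const_div_atTop_nhds_zero_nat _
  have hle : ∀ᶠ s : ℕ in atTop,
      (1 / ((s + 2 : ℕ) : ℝ)) * Real.log ((fullBlocks L M (s + 2)).ncard : ℝ) + W L M * z ≤
        Real.log K / s + G := by
    filter_upwards [eventually_ge_atTop 1] with s hs
    have hs' : (0 : ℝ) < s := by exact_mod_cast hs
    have h1 := hbound s hs
    have h2 : (1 / ((s + 2 : ℕ) : ℝ)) * Real.log ((fullBlocks L M (s + 2)).ncard : ℝ) ≤
        (1 / (s : ℝ)) * Real.log ((fullBlocks L M (s + 2)).ncard : ℝ) := by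
      refine mul_le_mul_of_nonneg_right ?_ (log_ncard_fullBlocks_nonneg L M _)
      exact one_div_le_one_div_of_le hs' (by push_cast; linarith)
    have h3 : (1 / (s : ℝ)) * Real.log ((fullBlocks L M (s + 2)).ncard : ℝ) + W L M * z ≤
        Real.log K / s + G := by
      have := div_le_div_of_nonneg_right h1 hs'.le
      rw [add_div, add_div, mul_div_cancel_right₀ _ hs'.ne', mul_div_cancel_left₀ _ hs'.ne'] at this
      rwa [one_div_mul_eq_div]
    linarith
  have := le_of_tendsto_of_tendsto (hβ.add_const (W L M * z : ℝ)) (hC.add_const G) hle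
  linarith

theorem dualFreeEnergy_le {L : ℕ} (M : ℕ) (hL : 0 < L) (z : ℝ) {t : ℕ} (ht : 2 ≤ t) :
    dualFreeEnergy L M z ≤ W L M * z + (1 / (t : ℝ)) * Real.log (blockSum L M t z) := by
  have hZ : 0 < blockSum L M t z := by
    obtain ⟨t, rfl⟩ := Nat.exists_eq_add_of_le' ht
    exact blockSum_pos hL t z
  set K := W L M * z + (1 / (t : ℝ)) * Real.log (blockSum L M t z) with hK
  have ht0 : (0 : ℝ) < t := by exact_mod_cast (by lia : 0 < t)
  have hφ : Tendsto (fun m : ℕ => (m + 2) * t - 1) atTop atTop := by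
    refine tendsto_atTop_mono (fun m => ?_) tendsto_id
    have : (m + 2) * 2 ≤ (m + 2) * t := Nat.mul_le_mul_left _ ht
    dsimp only [id]
    lia
  have hlim := (tendsto_dualFreeEnergy M hL z).1.comp hφ
  have hlim' : Tendsto (fun n : ℕ => K + K / n) atTop (𝓝 (K + 0)) :=
    tendsto_const_nhds.add (tendsto_const_div_atTop_nhds_zero_nat K)
  rw [add_zero] at hlim'
  refine le_of_tendsto_of_tendsto' hlim (hlim'.comp hφ) fun m => ?_
  simp only [Function.comp_apply]
  have hmt : (m + 2) * 2 ≤ (m + 2) * t := Nat.mul_le_mul_left _ ht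
  set n := (m + 2) * t - 1 with hn
  have hn1 : n + 1 = (m + 2) * t := by lia
  have hn0 : (0 : ℝ) < n := by exact_mod_cast (by lia : 0 < n)
  rw [QStar_eq (by lia)]
  have h1 := cappedSum_le L M n z
  rw [hn1] at h1
  have h2 := h1.trans (mul_le_mul_of_nonneg_left (blockSum_mul_le L M t (m + 1) z)
    (Real.exp_pos _).le)
  have h3 := Real.log_le_log (cappedSum_pos hL (by lia) z) h2
  rw [Real.log_mul (Real.exp_pos _).ne' (pow_pos hZ _).ne', Real.log_exp, Real.log_pow] at h3
  have h4 : z * (W L M * (((m + 1 + 1) * t : ℕ) : ℝ)) +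
      ((m + 1 + 1 : ℕ) : ℝ) * Real.log (blockSum L M t z) = (n + 1) * K := by
    have : ((n : ℝ) + 1) = (m + 2) * t := by exact_mod_cast hn1
    rw [this, hK]
    push_cast
    field_simp
    ring
  have h5 : K + K / n = (1 / (n : ℝ)) * ((n + 1) * K) := by
    field_simp
  rw [h5, ← h4]
  exact mul_le_mul_of_nonneg_left h3 (by positivity)

end TubePolygon

theorem mainTheorem5 (L M : ℕ) (hpos : 0 < L ∨ 0 < M) (hLM : M ≤ L) :
    (∀ z : ℝ, Tendsto (fun s : ℕ => (1 / (s : ℝ)) * Real.log (TubePolygon.QStar L M s z))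
      atTop (𝓝 (TubePolygon.dualFreeEnergy L M z))) ∧
    Tendsto (fun s : ℕ => (1 / (s : ℝ)) * Real.log ((TubePolygon.fullBlocks L M s).ncard : ℝ))
      atTop (𝓝 (TubePolygon.betaFull L M)) ∧
    Tendsto (fun z : ℝ => TubePolygon.dualFreeEnergy L M z - (TubePolygon.W L M : ℝ) * z)
      atTop (𝓝 (TubePolygon.betaFull L M)) := by
  have hL : 0 < L := by lia
  refine ⟨fun z => (TubePolygon.tendsto_dualFreeEnergy M hL z).1,
    TubePolygon.tendsto_betaFull L M, tendsto_order.2 ⟨fun l hl => ?_, fun r hr => ?_⟩⟩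
  · filter_upwards [eventually_ge_atTop 0] with z hz
    have := TubePolygon.betaFull_le M hL hz
    linarith
  · obtain ⟨t, htr, ht⟩ := (((TubePolygon.tendsto_betaFull L M).eventually_lt_const hr).and
      (eventually_ge_atTop 2)).exists
    have h1 := ((TubePolygon.tendsto_blockSum L M t).log
      (TubePolygon.ncard_fullBlocks_pos M hL t).ne').const_mul (1 / (t : ℝ))
    filter_upwards [h1.eventually_lt_const htr] with z hz
    have := TubePolygon.dualFreeEnergy_le M hL z ht
    linarith
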